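/- Let $\Omega=(0,1)$ and $1<s<2$, and put $\alpha=s/2\in(1/2,1)$. Let $\tilde H^{\alpha}(\Omega)$ be the space of real functions $u\in L^2(\Omega)$ whose extension by zero to $\mathbb{R}$ (again denoted $u$) lies in $H^{\alpha}(\mathbb{R})$, with the norm $$\|u\|_{\tilde H^{\alpha}(\Omega)}^2=\int_{\mathbb{R}}|u(x)|^2\,dx+\int_{\mathbb{R}}\int_{\mathbb{R}}\frac{|u(x)-u(y)|^2}{|x-y|^{1+2\alpha}}\,dx\,dy .$$ For $u\in\tilde H^{\alpha}(\Omega)$ let $${}_0D_x^{\alpha}u=\frac{d}{dx}\,\frac{1}{\Gamma(1-\alpha)}\int_0^x (x-y)^{-\alpha}u(y)\,dy,\qquad {}_xD_1^{\alpha}u=-\frac{d}{dx}\,\frac{1}{\Gamma(1-\alpha)}\int_x^1 (y-x)^{-\alpha}u(y)\,dy$$ be the left- and right-sided Riemann–Liouville derivatives, where $d/dx$ is the weak derivative on $\Omega$. Then both derivatives exist in $L^2(\Omega)$ for every $u\in\tilde H^{\alpha}(\Omega)$, and the form $$\mathcal{A}(u,v)=-\int_\Omega \big({}_0D_x^{s/2}u\big)(x)\,\big({}_xD_1^{s/2}v\big)(x)\,dx,\qquad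 u,v\in\tilde H^{s/2}(\Omega),$$ is coercive: there is a constant $c>0$, depending only on $s$, such that $$\mathcal{A}(u,u)\ \ge\ c\,\|u\|^2_{\tilde H^{s/2}(\Omega)}\qquad\text{for all }u\in\tilde H^{s/2}(\Omega).$$ Moreover $\mathcal{A}$ is monotone: $\mathcal{A}(u,u-v)-\mathcal{A}(v,u-v)\ge 0$ for all $u,v\in\tilde H^{s/2}(\Omega)$, with strict inequality whenever $u\ne v$ as elements of $\tilde H^{s/2}(\Omega)$. -/

import Mathlib

open MeasureTheory Set
open scoped ContDiff

noncomputable section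

namespace FracBVP

/-- The interior of the unit interval (the end points are a null set). -/
def Omega : Set ℝ := Ioo 0 1

/-- Left-sided fractional integral of order `β` with base point `a`. -/
def leftFracIntegral (a β : ℝ) (u : ℝ → ℝ) (x : ℝ) : ℝ :=
  1 / Real.Gamma β * ∫ y in a..x, (x - y) ^ (β - 1) * u y

/-- Right-sided fractional integral of order `β` with base point `b`. -/
def rightFracIntegral (b β : ℝ) (u : ℝ → ℝ) (x : ℝ) : ℝ :=
  1 / Real.Gamma β * ∫ y in x..b, (y - x) ^ (β - 1) * u y

/-- `g` is the weak (distributional) derivative of `F` on the open set `U`. -/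
def IsWeakDerivOn (F g : ℝ → ℝ) (U : Set ℝ) : Prop :=
  LocallyIntegrableOn F U ∧ LocallyIntegrableOn g U ∧
    ∀ φ : ℝ → ℝ, ContDiff ℝ ∞ φ → HasCompactSupport φ → tsupport φ ⊆ U →
      ∫ x in U, F x * deriv φ x = -∫ x in U, g x * φ x

/-- `g ∈ L²(0,1)` is the left-sided Riemann-Liouville derivative `D ₀I^{1-α} u` of order
`α ∈ (0,1)` on the unit interval. -/
def HasLeftRLDeriv (α : ℝ) (u g : ℝ → ℝ) : Prop :=
  MemLp g 2 (volume.restrict Omega) ∧ IsWeakDerivOn (leftFracIntegral 0 (1 - α) u) g Omega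

/-- `g ∈ L²(0,1)` is the right-sided Riemann-Liouville derivative `-D ₓI₁^{1-α} u` of order
`α ∈ (0,1)` on the unit interval. -/
def HasRightRLDeriv (α : ℝ) (u g : ℝ → ℝ) : Prop :=
  MemLp g 2 (volume.restrict Omega) ∧
    IsWeakDerivOn (rightFracIntegral 1 (1 - α) u) (fun x => -g x) Omega

open Classical in
/-- The left-sided Riemann-Liouville derivative (unique up to null sets where it exists). -/
def leftRLDeriv (α : ℝ) (u : ℝ → ℝ) : ℝ → ℝ :=
  if h : ∃ g, HasLeftRLDeriv α u g then h.choose else 0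

open Classical in
/-- The right-sided Riemann-Liouville derivative (unique up to null sets where it exists). -/
def rightRLDeriv (α : ℝ) (u : ℝ → ℝ) : ℝ → ℝ :=
  if h : ∃ g, HasRightRLDeriv α u g then h.choose else 0

/-- The integrand of the squared Slobodeckij semi-norm of order `α`. -/
def slobodeckijKernel (α : ℝ) (u : ℝ → ℝ) (p : ℝ × ℝ) : ℝ :=
  (u p.1 - u p.2) ^ 2 / |p.1 - p.2| ^ (1 + 2 * α)

/-- `u` belongs to `H̃^α(0,1)` for `α ∈ (0,1)`: it vanishes outside the unit interval (that is, it
is the extension by zero of a function on the interval) and lies in `H^α(ℝ)`. -/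
def MemHTilde (α : ℝ) (u : ℝ → ℝ) : Prop :=
  MemLp u 2 volume ∧ (∀ᵐ x, x ∉ Omega → u x = 0) ∧
    Integrable (slobodeckijKernel α u) (volume.prod volume)

/-- The norm of `H̃^α(0,1)`: the Sobolev-Slobodeckij norm on `ℝ` of the extension by zero. -/
def hTildeNorm (α : ℝ) (u : ℝ → ℝ) : ℝ :=
  Real.sqrt ((∫ x, u x ^ 2) + ∫ p, slobodeckijKernel α u p ∂(volume.prod volume))

/-- The form `A(u,v) = -(₀D^{s/2} u, ₓD₁^{s/2} v)` with the scalar product of `L²(0,1)`. -/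
def formA (s : ℝ) (u v : ℝ → ℝ) : ℝ :=
  -∫ x in Omega, leftRLDeriv (s / 2) u x * rightRLDeriv (s / 2) v x

end FracBVP

end

/-!
The translates of `u` form a curve in `L²(ℝ)` whose increments have norms depending only on the
shift: `‖γ t - γ τ‖² = w (t - τ)`. The Riemann-Liouville derivatives of `u` are, up to the factor
`Γ(1 - α)`, the Marchaud derivatives `α ∫₀^∞ t^(-1-α) (γ 0 - γ t) dt` of this curve and of the
reversed one, taken as limits of the regularisation by the kernel `(t + ε)^(-1-α)`. All inner
products of regularised derivatives are double integrals of `w`, and `∫ w h h^(-1-2α) dh` is half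
the squared Slobodeckij semi-norm. Hence the regularised derivatives converge in `L²(ℝ)`.

The derivatives from the left and from the right vanish to the left and to the right of the
interval, so that the form is an inner product over all of `ℝ`. Regularised, it is half the integral
of `w` against a kernel which dominates one converging to a multiple of `h^(-1-2α)`, with a positive
factor for `α > 1/2`; this bounds the form below by the semi-norm. The semi-norm controls the `L²`
norm because `w h = 2 ‖u‖²` for `h ≥ 1`, when `u` and its translate have disjoint supports.
-/

noncomputable section

namespace FracBVP

open Filter Topology

/-- Lebesgue measure on the positive half-line. -/
abbrev halfLine : Measure ℝ := volume.restrict (Ioi 0)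

lemma ae_halfLine_prod : ∀ᵐ p : ℝ × ℝ ∂(halfLine.prod halfLine), 0 < p.1 ∧ 0 < p.2 := by
  rw [Measure.prod_restrict]
  exact ae_restrict_mem (measurableSet_Ioi.prod measurableSet_Ioi)

/-- The kernel `α t ^ (-1 - α)` of the Marchaud derivative of order `α`, shifted by `ε` to remove
its singularity at the origin. -/
def marchaudKernel (α ε t : ℝ) : ℝ := α * (t + ε) ^ (-1 - α)

/-- The kernel to which the product of two regularised Marchaud derivatives of a curve with
stationary increments reduces: it multiplies the squared size of the increment over `h`, where
`p = (t, h)` and `t` is the smaller of the two integration variables. -/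
def incrKernel (α ε δ : ℝ) (p : ℝ × ℝ) : ℝ :=
  (marchaudKernel α ε p.2 - marchaudKernel α ε (p.1 + p.2)) * marchaudKernel α δ p.1

section Kernel

variable {α : ℝ}

@[fun_prop]
lemma measurable_marchaudKernel (α ε : ℝ) : Measurable (marchaudKernel α ε) := by
  unfold marchaudKernel
  fun_prop

lemma marchaudKernel_nonneg (hα : 0 ≤ α) {ε t : ℝ} (h : 0 ≤ t + ε) : 0 ≤ marchaudKernel α ε t :=
  mul_nonneg hα (Real.rpow_nonneg h _)

lemma marchaudKernel_anti (hα : 0 ≤ α) {ε δ s t : ℝ} (h : 0 < s + ε) (hst : s + ε ≤ t + δ) :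
    marchaudKernel α δ t ≤ marchaudKernel α ε s :=
  mul_le_mul_of_nonneg_left (Real.rpow_le_rpow_of_nonpos h hst (by linarith)) hα

lemma tendsto_marchaudKernel {t : ℝ} (ht : 0 < t) :
    Tendsto (fun ε => marchaudKernel α ε t) (𝓝[>] 0) (𝓝 (marchaudKernel α 0 t)) := by
  have h : ContinuousAt (fun ε => marchaudKernel α ε t) 0 :=
    continuousAt_const.mul (ContinuousAt.rpow_const (by fun_prop) (Or.inl (by simpa using ht.ne')))
  exact h.tendsto.mono_left nhdsWithin_le_nhds

lemma integrable_marchaudKernel (hα : 0 < α) {ε : ℝ} (hε : 0 < ε) :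
    Integrable (marchaudKernel α ε) halfLine :=
  (integrableOn_add_rpow_Ioi_of_lt (by linarith) (by linarith)).const_mul α

lemma integral_marchaudKernel (hα : 0 < α) {ε : ℝ} (hε : 0 < ε) :
    ∫ t, marchaudKernel α ε t ∂halfLine = ε ^ (-α) := by
  have hshift := (measurePreserving_add_right volume ε).setIntegral_preimage_emb
    (measurableEmbedding_addRight ε) (fun t : ℝ => t ^ (-1 - α)) (Ioi ε)
  simp only [preimage_add_const_Ioi, sub_self] at hshift
  simp only [marchaudKernel]
  rw [integral_const_mul, hshift, integral_Ioi_rpow_of_lt (by linarith) hε,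
    show -1 - α + 1 = -α by ring]
  field_simp

lemma marchaudKernel_zero_mul {c t : ℝ} (hc : 0 ≤ c) (ht : 0 ≤ t) :
    marchaudKernel α 0 (c * t) = c ^ (-1 - α) * marchaudKernel α 0 t := by
  simp only [marchaudKernel, add_zero, Real.mul_rpow hc ht]
  ring

lemma measurable_incrKernel (α ε δ : ℝ) : Measurable (incrKernel α ε δ) := by
  unfold incrKernel
  fun_prop

lemma incrKernel_nonneg (hα : 0 ≤ α) {ε δ : ℝ} (hε : 0 ≤ ε) (hδ : 0 ≤ δ) {p : ℝ × ℝ}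
    (h₁ : 0 < p.1) (h₂ : 0 < p.2) : 0 ≤ incrKernel α ε δ p :=
  mul_nonneg (sub_nonneg.2 (marchaudKernel_anti hα (by linarith) (by linarith)))
    (marchaudKernel_nonneg hα (by linarith))

lemma antitoneOn_rpow_sub_rpow_add {p t : ℝ} (hp : p ≤ 0) (ht : 0 ≤ t) :
    AntitoneOn (fun x : ℝ => x ^ p - (x + t) ^ p) (Ioi 0) := by
  have hderiv : ∀ x : ℝ, 0 < x → HasDerivAt (fun x : ℝ => x ^ p - (x + t) ^ p)
      (p * x ^ (p - 1) - p * (x + t) ^ (p - 1)) x := fun x hx => by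
    have hxt := ((hasDerivAt_id x).add_const t).rpow_const (p := p) (Or.inl (by simp; linarith))
    simpa using (Real.hasDerivAt_rpow_const (Or.inl hx.ne')).fun_sub hxt
  refine antitoneOn_of_hasDerivWithinAt_nonpos (convex_Ioi 0)
    (fun x hx => (hderiv x hx).continuousAt.continuousWithinAt)
    (fun x hx => (hderiv x (by simpa using hx)).hasDerivWithinAt) fun x hx => ?_
  have hx : 0 < x := by simpa using hx
  rw [← mul_sub]
  exact mul_nonpos_of_nonpos_of_nonneg hp
    (sub_nonneg.2 (Real.rpow_le_rpow_of_nonpos hx (by linarith) (by linarith)))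

lemma incrKernel_le_incrKernel_zero (hα : 0 ≤ α) {ε δ : ℝ} (hε : 0 ≤ ε) (hδ : 0 ≤ δ)
    {p : ℝ × ℝ} (h₁ : 0 < p.1) (h₂ : 0 < p.2) : incrKernel α ε δ p ≤ incrKernel α 0 0 p := by
  refine mul_le_mul ?_ (marchaudKernel_anti hα (by linarith) (by linarith))
    (marchaudKernel_nonneg hα (by linarith))
    (sub_nonneg.2 (marchaudKernel_anti hα (by linarith) (by linarith)))
  have hanti := antitoneOn_rpow_sub_rpow_add (p := -1 - α) (by linarith) h₁.le
    (mem_Ioi.2 h₂) (mem_Ioi.2 (by linarith : 0 < p.2 + ε)) (by linarith)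
  simp only [marchaudKernel, ← mul_sub, add_zero, add_comm p.1 p.2]
  rw [add_right_comm p.2 p.1 ε]
  exact mul_le_mul_of_nonneg_left hanti hα

lemma incrKernel_zero_mul {h t : ℝ} (hh : 0 < h) (ht : 0 < t) :
    incrKernel α 0 0 (h * t, h) = h ^ (-2 - 2 * α) * incrKernel α 0 0 (t, 1) := by
  have hadd : h * t + h = h * (t + 1) := by ring
  have hone := marchaudKernel_zero_mul (α := α) hh.le zero_le_one
  rw [mul_one] at hone
  simp only [incrKernel]
  rw [hadd, hone, marchaudKernel_zero_mul hh.le ht.le,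
    marchaudKernel_zero_mul hh.le (by linarith),
    show -2 - 2 * α = (-1 - α) + (-1 - α) by ring, Real.rpow_add hh]
  ring

lemma one_sub_rpow_one_add_le (hα : 0 ≤ α) {t : ℝ} (ht : 0 ≤ t) :
    1 - (t + 1) ^ (-1 - α) ≤ (1 + α) * t := by
  have hpos : 0 < t + 1 := by linarith
  have bernoulli := one_add_mul_self_le_rpow_one_add (s := (t + 1)⁻¹ - 1) (p := 1 + α)
    (by linarith [inv_pos.2 hpos]) (by linarith)
  rw [add_sub_cancel, Real.inv_rpow hpos.le, ← Real.rpow_neg hpos.le, neg_add'] at bernoulli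
  have hinv : 1 - (t + 1)⁻¹ ≤ t := by
    rw [show 1 - (t + 1)⁻¹ = t / (t + 1) by field_simp; ring]
    exact div_le_self ht (by linarith)
  nlinarith

/-- Near the origin the difference in the kernel gains a factor `t`. -/
lemma integrable_incrKernel_one (hα : 0 < α) (hα1 : α < 1) :
    Integrable (fun t => incrKernel α 0 0 (t, 1)) halfLine := by
  have hmeas : Measurable fun t => incrKernel α 0 0 (t, 1) :=
    (measurable_incrKernel α 0 0).comp (measurable_id.prodMk measurable_const)
  have hsplit : Ioi (0 : ℝ) = Ioc 0 1 ∪ Ioi 1 := (Ioc_union_Ioi_eq_Ioi zero_le_one).symm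
  rw [halfLine, hsplit, ← IntegrableOn, integrableOn_union]
  constructor
  · have hbound : IntegrableOn (fun t : ℝ => α ^ 2 * (1 + α) * t ^ (-α)) (Ioc 0 1) := by
      rw [← intervalIntegrable_iff_integrableOn_Ioc_of_le zero_le_one]
      exact (intervalIntegral.intervalIntegrable_rpow' (by linarith)).const_mul _
    refine hbound.mono' hmeas.aestronglyMeasurable (ae_restrict_of_forall_mem measurableSet_Ioc ?_)
    intro t ht
    rw [Real.norm_of_nonneg (incrKernel_nonneg hα.le le_rfl le_rfl ht.1 one_pos)]
    have hpow : t * t ^ (-1 - α) = t ^ (-α) := by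
      rw [← Real.rpow_one_add' ht.1.le (by linarith)]
      ring_nf
    calc incrKernel α 0 0 (t, 1) = α ^ 2 * t ^ (-1 - α) * (1 - (t + 1) ^ (-1 - α)) := by
          simp only [incrKernel, marchaudKernel, add_zero, Real.one_rpow]; ring
      _ ≤ α ^ 2 * t ^ (-1 - α) * ((1 + α) * t) :=
          mul_le_mul_of_nonneg_left (one_sub_rpow_one_add_le hα.le ht.1.le)
            (mul_nonneg (sq_nonneg α) (Real.rpow_nonneg ht.1.le _))
      _ = α ^ 2 * (1 + α) * t ^ (-α) := by rw [← hpow]; ring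
  · have hbound : IntegrableOn (fun t : ℝ => α ^ 2 * t ^ (-1 - α)) (Ioi 1) :=
      (integrableOn_Ioi_rpow_of_lt (by linarith) one_pos).const_mul _
    refine hbound.mono' hmeas.aestronglyMeasurable (ae_restrict_of_forall_mem measurableSet_Ioi ?_)
    intro t ht
    have ht0 : 0 < t := one_pos.trans ht
    rw [Real.norm_of_nonneg (incrKernel_nonneg hα.le le_rfl le_rfl ht0 one_pos)]
    have hpos := Real.rpow_nonneg (add_pos ht0 one_pos).le (-1 - α)
    have hk := mul_nonneg (sq_nonneg α) (Real.rpow_nonneg ht0.le (-1 - α))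
    simp only [incrKernel, marchaudKernel, add_zero, Real.one_rpow]
    nlinarith

lemma integrable_incrKernel_zero (hα : 0 < α) (hα1 : α < 1) {h : ℝ} (hh : 0 < h) :
    Integrable (fun t => incrKernel α 0 0 (t, h)) halfLine := by
  have hscale := integrableOn_Ioi_comp_mul_left_iff (fun t => incrKernel α 0 0 (t, h)) 0 hh
  rw [mul_zero] at hscale
  refine hscale.1 (((integrable_incrKernel_one hα hα1).const_mul (h ^ (-2 - 2 * α))).congr ?_)
  filter_upwards [ae_restrict_mem measurableSet_Ioi] with t ht
  exact (incrKernel_zero_mul hh ht).symm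

lemma integral_incrKernel_zero {h : ℝ} (hh : 0 < h) :
    ∫ t, incrKernel α 0 0 (t, h) ∂halfLine
      = h ^ (-1 - 2 * α) * ∫ t, incrKernel α 0 0 (t, 1) ∂halfLine := by
  have hscale := integral_comp_mul_left_Ioi' (fun t => incrKernel α 0 0 (t, h)) 0 hh
  rw [mul_zero] at hscale
  rw [← hscale, setIntegral_congr_fun measurableSet_Ioi fun t ht => incrKernel_zero_mul hh ht,
    integral_const_mul, smul_eq_mul, ← mul_assoc, mul_comm h, ← Real.rpow_add_one hh.ne']
  ring_nf

lemma integrable_mul_incrKernel_zero (hα : 0 < α) (hα1 : α < 1) {w : ℝ → ℝ} (hw : Measurable w)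
    (hi : Integrable (fun h => w h * h ^ (-1 - 2 * α)) halfLine) :
    Integrable (fun p : ℝ × ℝ => w p.2 * incrKernel α 0 0 p) (halfLine.prod halfLine) := by
  have hmeas : Measurable fun p : ℝ × ℝ => w p.2 * incrKernel α 0 0 p :=
    (hw.comp measurable_snd).mul (measurable_incrKernel α 0 0)
  rw [integrable_prod_iff' hmeas.aestronglyMeasurable]
  constructor
  · filter_upwards [ae_restrict_mem measurableSet_Ioi] with h hh
    exact (integrable_incrKernel_zero hα hα1 hh).const_mul _
  · refine (hi.norm.mul_const (∫ t, incrKernel α 0 0 (t, 1) ∂halfLine)).congr ?_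
    filter_upwards [ae_restrict_mem measurableSet_Ioi] with h hh
    have hnorm : ∀ t ∈ Ioi (0 : ℝ),
        ‖w h * incrKernel α 0 0 (t, h)‖ = ‖w h‖ * incrKernel α 0 0 (t, h) := fun t ht => by
      rw [norm_mul, Real.norm_of_nonneg
        (incrKernel_nonneg (p := (t, h)) hα.le le_rfl le_rfl ht hh)]
    rw [setIntegral_congr_fun measurableSet_Ioi hnorm, integral_const_mul,
      integral_incrKernel_zero hh, norm_mul, Real.norm_of_nonneg (Real.rpow_nonneg (le_of_lt hh) _)]
    ring

end Kernel

section MixedKernel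

variable {α : ℝ}

/-- The kernel through which the squared sizes of the increments of a curve `γ` enter twice the
negative scalar product of the regularised Marchaud derivatives of `γ` and `t ↦ γ (-t)`. -/
def mixedKernel (α ε h : ℝ) : ℝ :=
  (∫ t in 0..h, marchaudKernel α ε t * marchaudKernel α ε (h - t))
    - 2 * ε ^ (-α) * marchaudKernel α ε h

/-- An explicit lower bound for `mixedKernel`, with a limit as `ε` tends to `0` that is positive
when `1 / 2 < α`. -/
def mixedMinorant (α ε h : ℝ) : ℝ :=
  2 * α * (2 * α - 1) * 4 ^ α * (h * (h + 2 * ε) ^ (-2 - 2 * α))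
    - 8 * α * (ε ^ (1 - α) * (h + ε) ^ (-2 - α))

lemma measurable_mixedMinorant (α ε : ℝ) : Measurable (mixedMinorant α ε) := by
  unfold mixedMinorant
  fun_prop

lemma mixedMinorant_zero (hα1 : α ≠ 1) {h : ℝ} (hh : 0 < h) :
    mixedMinorant α 0 h = 2 * α * (2 * α - 1) * 4 ^ α * h ^ (-1 - 2 * α) := by
  have hpow : h * h ^ (-2 - 2 * α) = h ^ (-1 - 2 * α) := by
    rw [mul_comm, ← Real.rpow_add_one hh.ne']
    ring_nf
  simp only [mixedMinorant, Real.zero_rpow (sub_ne_zero.2 hα1.symm), mul_zero, add_zero, zero_mul,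
    sub_zero, hpow]

lemma tendsto_mixedMinorant (hα1 : α < 1) {h : ℝ} (hh : 0 < h) :
    Tendsto (fun ε => mixedMinorant α ε h) (𝓝[>] 0)
      (𝓝 (2 * α * (2 * α - 1) * 4 ^ α * h ^ (-1 - 2 * α))) := by
  have hcont : ContinuousAt (fun ε => mixedMinorant α ε h) 0 := by
    have hε : ContinuousAt (fun ε : ℝ => ε ^ (1 - α)) 0 :=
      continuousAt_id.rpow_const (Or.inr (by linarith))
    have h₁ : ContinuousAt (fun ε : ℝ => (h + 2 * ε) ^ (-2 - 2 * α)) 0 :=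
      ContinuousAt.rpow_const (by fun_prop) (Or.inl (by simpa using hh.ne'))
    have h₂ : ContinuousAt (fun ε : ℝ => (h + ε) ^ (-2 - α)) 0 :=
      ContinuousAt.rpow_const (by fun_prop) (Or.inl (by simpa using hh.ne'))
    unfold mixedMinorant
    fun_prop
  rw [← mixedMinorant_zero hα1.ne hh]
  exact hcont.tendsto.mono_left nhdsWithin_le_nhds

lemma abs_mixedMinorant_le (hα : 1 / 2 ≤ α) (hα1 : α ≤ 1) {ε h : ℝ} (hε : 0 < ε) (hh : 0 < h) :
    |mixedMinorant α ε h| ≤ (2 * α * (2 * α - 1) * 4 ^ α + 8 * α) * h ^ (-1 - 2 * α) := by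
  have hα0 : 0 < α := by linarith
  have hmain : h * (h + 2 * ε) ^ (-2 - 2 * α) ≤ h ^ (-1 - 2 * α) := by
    calc h * (h + 2 * ε) ^ (-2 - 2 * α) ≤ h * h ^ (-2 - 2 * α) := by
          gcongr 1
          exact Real.rpow_le_rpow_of_nonpos hh (by linarith) (by linarith)
      _ = h ^ (-1 - 2 * α) := by
          rw [mul_comm, ← Real.rpow_add_one hh.ne']
          ring_nf
  have herror : ε ^ (1 - α) * (h + ε) ^ (-2 - α) ≤ h ^ (-1 - 2 * α) := by
    calc ε ^ (1 - α) * (h + ε) ^ (-2 - α) ≤ (h + ε) ^ (1 - α) * (h + ε) ^ (-2 - α) := by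
          gcongr
          linarith
      _ = (h + ε) ^ (-1 - 2 * α) := by
          rw [← Real.rpow_add (by positivity)]
          ring_nf
      _ ≤ h ^ (-1 - 2 * α) := Real.rpow_le_rpow_of_nonpos hh (by linarith) (by linarith)
  have hc : 0 ≤ 2 * α * (2 * α - 1) * 4 ^ α :=
    mul_nonneg (mul_nonneg (by linarith) (by linarith)) (by positivity)
  calc |mixedMinorant α ε h|
      ≤ |2 * α * (2 * α - 1) * 4 ^ α * (h * (h + 2 * ε) ^ (-2 - 2 * α))|
        + |8 * α * (ε ^ (1 - α) * (h + ε) ^ (-2 - α))| := abs_sub _ _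
    _ = 2 * α * (2 * α - 1) * 4 ^ α * (h * (h + 2 * ε) ^ (-2 - 2 * α))
        + 8 * α * (ε ^ (1 - α) * (h + ε) ^ (-2 - α)) := by
          rw [abs_of_nonneg (by positivity), abs_of_nonneg (by positivity)]
    _ ≤ (2 * α * (2 * α - 1) * 4 ^ α) * h ^ (-1 - 2 * α) + 8 * α * h ^ (-1 - 2 * α) := by
          gcongr
    _ = _ := by ring

lemma continuousOn_mul_reflect_rpow {ε h : ℝ} (hε : 0 < ε) (hh : 0 ≤ h) (r : ℝ) :
    ContinuousOn (fun t => ((t + ε) * (h - t + ε)) ^ r) (uIcc 0 h) := by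
  rw [uIcc_of_le hh]
  refine ContinuousOn.rpow_const (by fun_prop) fun t ht => Or.inl ?_
  exact (mul_pos (by linarith [ht.1]) (by linarith [ht.2])).ne'

/-- The fundamental theorem of calculus for `t ↦ (h - 2 * t) * q t ^ (-α)` with
`q t = (t + ε) * (h - t + ε)`, where `q'² = (h + 2 * ε)² - 4 * q`. -/
lemma integral_mul_reflect_rpow {ε h : ℝ} (hε : 0 < ε) (hh : 0 ≤ h) (α : ℝ) :
    α * (h + 2 * ε) ^ 2 * ∫ t in 0..h, ((t + ε) * (h - t + ε)) ^ (-1 - α)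
      = (4 * α - 2) * (∫ t in 0..h, ((t + ε) * (h - t + ε)) ^ (-α))
        + 2 * h * (ε * (h + ε)) ^ (-α) := by
  set q : ℝ → ℝ := fun t => (t + ε) * (h - t + ε) with hq
  have hq_deriv (t : ℝ) : HasDerivAt q (h - 2 * t) t := by
    convert! ((hasDerivAt_id t).add_const ε).mul (((hasDerivAt_id t).const_sub h).add_const ε)
      using 1
    simp only [id]
    ring
  have hderiv : ∀ t ∈ uIcc 0 h, HasDerivAt (fun t => (h - 2 * t) * q t ^ (-α))
      ((4 * α - 2) * q t ^ (-α) - α * (h + 2 * ε) ^ 2 * q t ^ (-1 - α)) t := by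
    intro t ht
    rw [uIcc_of_le hh] at ht
    have hqt : q t ≠ 0 := (mul_pos (by linarith [ht.1]) (by linarith [ht.2])).ne'
    have hpow : q t ^ (-α) = q t ^ (-1 - α) * q t := by
      rw [← Real.rpow_add_one hqt]
      ring_nf
    convert! (((hasDerivAt_id t).const_mul 2).const_sub h).mul
      ((hq_deriv t).rpow_const (p := -α) (Or.inl hqt)) using 1
    simp only [id, show -α - 1 = -1 - α by ring, hpow]
    simp only [hq]
    ring
  have hint (r : ℝ) : IntervalIntegrable (fun t => q t ^ r) volume 0 h :=
    (continuousOn_mul_reflect_rpow hε hh r).intervalIntegrable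
  have hftc := intervalIntegral.integral_eq_sub_of_hasDerivAt hderiv
    (((hint _).const_mul _).sub ((hint _).const_mul _))
  rw [intervalIntegral.integral_sub ((hint _).const_mul _) ((hint _).const_mul _),
    intervalIntegral.integral_const_mul, intervalIntegral.integral_const_mul,
    show q h = ε * (h + ε) by simp only [hq]; ring,
    show q 0 = ε * (h + ε) by simp only [hq]; ring] at hftc
  linarith

lemma le_integral_mul_reflect_rpow {ε h : ℝ} (hα : 0 ≤ α) (hε : 0 < ε) (hh : 0 ≤ h) :
    4 ^ α * (h * (h + 2 * ε) ^ (-2 * α)) ≤ ∫ t in 0..h, ((t + ε) * (h - t + ε)) ^ (-α) := by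
  have hL : 0 < h + 2 * ε := by positivity
  have hmax : 4 ^ α * (h + 2 * ε) ^ (-2 * α) = (((h + 2 * ε) / 2) ^ 2) ^ (-α) := by
    rw [div_pow, Real.div_rpow (by positivity) (by positivity), ← Real.rpow_natCast,
      ← Real.rpow_mul hL.le]
    norm_num [Real.rpow_neg, mul_comm]
  have hconst : 4 ^ α * (h * (h + 2 * ε) ^ (-2 * α))
      = ∫ _ in 0..h, 4 ^ α * (h + 2 * ε) ^ (-2 * α) := by
    rw [intervalIntegral.integral_const, sub_zero, smul_eq_mul]
    ring
  rw [hconst]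
  refine intervalIntegral.integral_mono_on hh intervalIntegrable_const
    (continuousOn_mul_reflect_rpow hε hh _).intervalIntegrable fun t ht => ?_
  rw [hmax]
  refine Real.rpow_le_rpow_of_nonpos (mul_pos (by linarith [ht.1]) (by linarith [ht.2])) ?_
    (by linarith)
  nlinarith [sq_nonneg (h - 2 * t)]

lemma integral_marchaudKernel_mul {ε h : ℝ} (hε : 0 ≤ ε) (hh : 0 ≤ h) :
    ∫ t in 0..h, marchaudKernel α ε t * marchaudKernel α ε (h - t)
      = α ^ 2 * ∫ t in 0..h, ((t + ε) * (h - t + ε)) ^ (-1 - α) := by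
  rw [← intervalIntegral.integral_const_mul]
  refine intervalIntegral.integral_congr fun t ht => ?_
  rw [uIcc_of_le hh] at ht
  simp only [marchaudKernel]
  rw [Real.mul_rpow (by linarith [ht.1]) (by linarith [ht.2])]
  ring

lemma mixedKernel_eq {ε h : ℝ} (hε : 0 < ε) (hh : 0 ≤ h) :
    mixedKernel α ε h
      = 2 * α * (2 * α - 1) / (h + 2 * ε) ^ 2 * (∫ t in 0..h, ((t + ε) * (h - t + ε)) ^ (-α))
        - 2 * α * ε ^ (-α) * (h + ε) ^ (-α) * (ε * (3 * h + 4 * ε))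
          / ((h + ε) * (h + 2 * ε) ^ 2) := by
  have hhε : 0 < h + ε := by positivity
  have hpow : (h + ε) ^ (-1 - α) = (h + ε) ^ (-α) / (h + ε) := by
    rw [← Real.rpow_sub_one hhε.ne']
    ring_nf
  have hint := integral_mul_reflect_rpow hε hh α
  rw [Real.mul_rpow hε.le hhε.le] at hint
  rw [mixedKernel, integral_marchaudKernel_mul hε.le hh, marchaudKernel, hpow,
    show ∀ J : ℝ, α ^ 2 * J = α * (α * (h + 2 * ε) ^ 2 * J) / (h + 2 * ε) ^ 2 by
      intro J; field_simp, hint]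
  field_simp
  ring

lemma mixedMinorant_le_mixedKernel (hα : 1 / 2 ≤ α) {ε h : ℝ} (hε : 0 < ε) (hh : 0 ≤ h) :
    mixedMinorant α ε h ≤ mixedKernel α ε h := by
  have hhε : 0 < h + ε := by positivity
  have hL : 0 < h + 2 * ε := by positivity
  have hα0 : 0 < α := by linarith
  rw [mixedKernel_eq hε hh, mixedMinorant]
  refine sub_le_sub ?_ ?_
  · have hpow : (h + 2 * ε) ^ (-2 - 2 * α) = (h + 2 * ε) ^ (-2 * α) / (h + 2 * ε) ^ 2 := by
      rw [← Real.rpow_natCast, ← Real.rpow_sub hL]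
      push_cast
      ring_nf
    calc 2 * α * (2 * α - 1) * 4 ^ α * (h * (h + 2 * ε) ^ (-2 - 2 * α))
        = 2 * α * (2 * α - 1) / (h + 2 * ε) ^ 2 * (4 ^ α * (h * (h + 2 * ε) ^ (-2 * α))) := by
          rw [hpow]; ring
      _ ≤ _ := mul_le_mul_of_nonneg_left (le_integral_mul_reflect_rpow hα0.le hε hh)
          (div_nonneg (mul_nonneg (by linarith) (by linarith)) (by positivity))
  · have hpow : (h + ε) ^ (-2 - α) = (h + ε) ^ (-α) / (h + ε) ^ 2 := by
      rw [← Real.rpow_natCast, ← Real.rpow_sub hhε]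
      push_cast
      ring_nf
    have hfrac : (3 * h + 4 * ε) / ((h + ε) * (h + 2 * ε) ^ 2) ≤ 4 / (h + ε) ^ 2 := by
      rw [div_le_div_iff₀ (by positivity) (by positivity)]
      have : 0 ≤ (h + ε) * (h ^ 2 + 9 * h * ε + 12 * ε ^ 2) := by positivity
      nlinarith
    have hpowε : ε ^ (1 - α) = ε ^ (-α) * ε := by
      rw [← Real.rpow_add_one hε.ne']
      ring_nf
    calc 2 * α * ε ^ (-α) * (h + ε) ^ (-α) * (ε * (3 * h + 4 * ε)) / ((h + ε) * (h + 2 * ε) ^ 2)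
        = 2 * α * ε ^ (-α) * (h + ε) ^ (-α) * ε
          * ((3 * h + 4 * ε) / ((h + ε) * (h + 2 * ε) ^ 2)) := by ring
      _ ≤ 2 * α * ε ^ (-α) * (h + ε) ^ (-α) * ε * (4 / (h + ε) ^ 2) := by gcongr
      _ = 8 * α * (ε ^ (1 - α) * (h + ε) ^ (-2 - α)) := by rw [hpow, hpowε]; ring

end MixedKernel

section Shear

variable {E : Type*} [NormedAddCommGroup E]

/-- The triangle (an eighth of the plane) `0 < t < h` in coordinates `(t, h)`. -/
def triangle : Set (ℝ × ℝ) := {p | 0 < p.1 ∧ p.1 < p.2}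

lemma measurableSet_triangle : MeasurableSet triangle :=
  (measurableSet_lt measurable_const measurable_fst).inter
    (measurableSet_lt measurable_fst measurable_snd)

lemma measurePreserving_shear : MeasurePreserving (fun p : ℝ × ℝ => (p.1, p.1 + p.2))
    (halfLine.prod halfLine) (volume.restrict triangle) := by
  have hpre : (fun p : ℝ × ℝ => (p.1, p.1 + p.2)) ⁻¹' triangle = Ioi 0 ×ˢ Ioi 0 := by
    ext p
    simp [triangle]
  rw [Measure.prod_restrict, ← hpre]
  exact (measurePreserving_prod_add volume volume).restrict_preimage measurableSet_triangle

lemma measurableEmbedding_shear : MeasurableEmbedding fun p : ℝ × ℝ => (p.1, p.1 + p.2) :=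
  (MeasurableEquiv.shearAddRight ℝ).measurableEmbedding

lemma setIntegral_triangle_eq [NormedSpace ℝ E] (k : ℝ × ℝ → E) :
    ∫ p in triangle, k p = ∫ p, k (p.1, p.1 + p.2) ∂(halfLine.prod halfLine) :=
  (measurePreserving_shear.integral_comp measurableEmbedding_shear k).symm

lemma integrableOn_triangle_iff {k : ℝ × ℝ → E} : IntegrableOn k triangle ↔
    Integrable (fun p => k (p.1, p.1 + p.2)) (halfLine.prod halfLine) :=
  (measurePreserving_shear.integrable_comp_emb measurableEmbedding_shear).symm

lemma integrable_shear {k : ℝ × ℝ → E} (hk : Integrable k (halfLine.prod halfLine)) :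
    Integrable (fun p => k (p.1, p.1 + p.2)) (halfLine.prod halfLine) := by
  rw [Measure.prod_restrict] at hk
  exact integrableOn_triangle_iff.1
    (IntegrableOn.mono_set hk fun p hp => ⟨hp.1, hp.1.trans hp.2⟩)

lemma ae_fst_ne_snd : ∀ᵐ p : ℝ × ℝ, p.1 ≠ p.2 := by
  refine (Measure.ae_prod_iff_ae_ae (p := fun p : ℝ × ℝ => p.1 ≠ p.2)
    (measurableSet_eq_fun measurable_fst measurable_snd).compl).2 ?_
  exact Eventually.of_forall fun x => (Measure.ae_ne volume x).mono fun _ h => h.symm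

lemma quadrant_ae_eq_triangle_union_swap :
    Ioi (0 : ℝ) ×ˢ Ioi (0 : ℝ) =ᵐ[volume] (triangle ∪ Prod.swap ⁻¹' triangle : Set (ℝ × ℝ)) := by
  filter_upwards [ae_fst_ne_snd] with p hp
  refine propext ⟨fun h => ?_, ?_⟩
  · exact hp.lt_or_gt.imp (fun hlt => ⟨h.1, hlt⟩) fun hlt => ⟨h.2, hlt⟩
  · rintro (h | h)
    · exact ⟨h.1, h.1.trans h.2⟩
    · exact ⟨h.1.trans h.2, h.1⟩

lemma integral_quadrant_eq_triangle_add [NormedSpace ℝ E] {k : ℝ × ℝ → E}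
    (hk : Integrable k (halfLine.prod halfLine)) :
    ∫ p, k p ∂(halfLine.prod halfLine)
      = (∫ p in triangle, k p) + ∫ p in triangle, k p.swap := by
  rw [Measure.prod_restrict, ← Measure.volume_eq_prod] at hk ⊢
  have hk' := IntegrableOn.congr_set_ae hk quadrant_ae_eq_triangle_union_swap.symm
  have hswap : ∫ p in Prod.swap ⁻¹' triangle, k p = ∫ p in triangle, k p.swap :=
    Measure.measurePreserving_swap.setIntegral_preimage_emb
      MeasurableEquiv.prodComm.measurableEmbedding (fun p => k p.swap) triangle
  have hdisj : Disjoint triangle (Prod.swap ⁻¹' triangle) :=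
    Set.disjoint_left.2 fun _ h h' => lt_asymm h.2 h'.2
  rw [setIntegral_congr_set quadrant_ae_eq_triangle_union_swap, setIntegral_union hdisj
    (measurable_swap measurableSet_triangle) hk'.left_of_union hk'.right_of_union, hswap]

lemma integral_indicator_triangle [NormedSpace ℝ E] (k : ℝ × ℝ → E) (h : ℝ) :
    ∫ t, triangle.indicator k (t, h) = (Ioi 0).indicator (fun h => ∫ t in 0..h, k (t, h)) h := by
  by_cases hh : 0 < h
  · rw [indicator_of_mem (mem_Ioi.2 hh), intervalIntegral.integral_of_le hh.le,
      integral_Ioc_eq_integral_Ioo, ← integral_indicator measurableSet_Ioo]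
    rfl
  · rw [indicator_of_notMem (notMem_Ioi.2 (not_lt.1 hh))]
    exact integral_eq_zero_of_ae (Eventually.of_forall fun t =>
      indicator_of_notMem (fun ht => hh (ht.1.trans ht.2)) _)

lemma integrable_integral_triangle [NormedSpace ℝ E] {k : ℝ × ℝ → E}
    (hk : IntegrableOn k triangle) : Integrable (fun h => ∫ t in 0..h, k (t, h)) halfLine := by
  rw [← integrable_indicator_iff measurableSet_triangle, Measure.volume_eq_prod] at hk
  have hi := hk.integral_prod_right
  simp only [integral_indicator_triangle] at hi
  exact (integrable_indicator_iff measurableSet_Ioi).1 hi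

lemma setIntegral_triangle_eq_integral [NormedSpace ℝ E] {k : ℝ × ℝ → E}
    (hk : IntegrableOn k triangle) :
    ∫ p in triangle, k p = ∫ h, (∫ t in 0..h, k (t, h)) ∂halfLine := by
  rw [← integrable_indicator_iff measurableSet_triangle, Measure.volume_eq_prod] at hk
  rw [← integral_indicator measurableSet_triangle, Measure.volume_eq_prod, integral_prod_symm _ hk]
  simp only [integral_indicator_triangle]
  exact integral_indicator measurableSet_Ioi

end Shear

section Marchaud

variable {H : Type*} [NormedAddCommGroup H] {α ε δ : ℝ}

lemma integrable_marchaudKernel_smul [NormedSpace ℝ H] (hα : 0 < α) (hε : 0 < ε) {f : ℝ → H}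
    (hf : Continuous f) (hb : ∃ M, ∀ t, ‖f t‖ ≤ M) :
    Integrable (fun t => marchaudKernel α ε t • f t) halfLine := by
  obtain ⟨M, hM⟩ := hb
  exact (integrable_marchaudKernel hα hε).smul_bdd M hf.aestronglyMeasurable
    (Eventually.of_forall hM)

lemma integrable_marchaudKernel_mul_mul (hα : 0 < α) (hε : 0 < ε) (hδ : 0 < δ)
    {b : ℝ × ℝ → ℝ} (hb : Continuous b) (hM : ∃ M, ∀ p, ‖b p‖ ≤ M) :
    Integrable (fun p : ℝ × ℝ => marchaudKernel α ε p.1 * marchaudKernel α δ p.2 * b p)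
      (halfLine.prod halfLine) := by
  obtain ⟨M, hM⟩ := hM
  exact ((integrable_marchaudKernel hα hε).mul_prod (integrable_marchaudKernel hα hδ)).mul_bdd
    hb.aestronglyMeasurable (Eventually.of_forall hM)

lemma integral_marchaudKernel_mul_mul_fst (hα : 0 < α) (hδ : 0 < δ) (w : ℝ → ℝ) :
    ∫ p : ℝ × ℝ, marchaudKernel α ε p.1 * marchaudKernel α δ p.2 * w p.1
        ∂(halfLine.prod halfLine)
      = δ ^ (-α) * ∫ h, w h * marchaudKernel α ε h ∂halfLine := by
  rw [← integral_marchaudKernel hα hδ, mul_comm, ← integral_prod_mul]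
  congr 1 with p
  ring

lemma integral_marchaudKernel_mul_mul_snd (hα : 0 < α) (hε : 0 < ε) (w : ℝ → ℝ) :
    ∫ p : ℝ × ℝ, marchaudKernel α ε p.1 * marchaudKernel α δ p.2 * w p.2
        ∂(halfLine.prod halfLine)
      = ε ^ (-α) * ∫ h, w h * marchaudKernel α δ h ∂halfLine := by
  rw [← integral_marchaudKernel hα hε, ← integral_prod_mul]
  congr 1 with p
  ring

lemma integral_marchaudKernel_mul_half (hα : 0 < α) (hε : 0 < ε) (hδ : 0 < δ) {w : ℝ → ℝ}
    (hw : Continuous w) (hM : ∃ M, ∀ t, ‖w t‖ ≤ M) {σ : ℝ × ℝ → ℝ} (hσ : Continuous σ) :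
    ∫ p : ℝ × ℝ, marchaudKernel α ε p.1 * marchaudKernel α δ p.2
        * ((w p.1 + w p.2 - w (σ p)) / 2) ∂(halfLine.prod halfLine)
      = (δ ^ (-α) * (∫ h, w h * marchaudKernel α ε h ∂halfLine)
        + ε ^ (-α) * (∫ h, w h * marchaudKernel α δ h ∂halfLine)
        - ∫ p : ℝ × ℝ, marchaudKernel α ε p.1 * marchaudKernel α δ p.2 * w (σ p)
          ∂(halfLine.prod halfLine)) / 2 := by
  have hint (f : ℝ × ℝ → ℝ) (hf : Continuous f) :
      Integrable (fun p : ℝ × ℝ => marchaudKernel α ε p.1 * marchaudKernel α δ p.2 * w (f p))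
        (halfLine.prod halfLine) :=
    integrable_marchaudKernel_mul_mul hα hε hδ (hw.comp hf) (hM.imp fun _ h p => h (f p))
  have hdiag : Integrable (fun p : ℝ × ℝ => marchaudKernel α ε p.1 * marchaudKernel α δ p.2 * w p.1
      + marchaudKernel α ε p.1 * marchaudKernel α δ p.2 * w p.2) (halfLine.prod halfLine) :=
    (hint _ continuous_fst).add (hint _ continuous_snd)
  rw [← integral_marchaudKernel_mul_mul_fst hα hδ, ← integral_marchaudKernel_mul_mul_snd hα hε,
    ← integral_add (hint _ continuous_fst) (hint _ continuous_snd),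
    ← integral_sub hdiag (hint _ hσ), ← integral_div]
  congr 1 with p
  ring

variable [InnerProductSpace ℝ H]

/-- The regularised Marchaud derivative of order `α` at the origin of a curve, from the side of
the positive half-line. -/
def marchaud (α : ℝ) (γ : ℝ → H) (ε : ℝ) : H :=
  ∫ t, marchaudKernel α ε t • (γ 0 - γ t) ∂halfLine

/-- The vector `G` is the Marchaud derivative of order `α` at the origin of the curve `γ`, from the
side of the positive half-line and up to the factor `Γ (1 - α)`. -/
def HasMarchaudDeriv (α : ℝ) (γ : ℝ → H) (G : H) : Prop :=
  Tendsto (marchaud α γ) (𝓝[>] 0) (𝓝 G)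

lemma integrable_marchaud (hα : 0 < α) (hε : 0 < ε) {γ : ℝ → H} (hγ : Continuous γ)
    (hM : ∃ M, ∀ t, ‖γ t‖ ≤ M) :
    Integrable (fun t => marchaudKernel α ε t • (γ 0 - γ t)) halfLine := by
  obtain ⟨M, hM⟩ := hM
  exact integrable_marchaudKernel_smul hα hε (continuous_const.sub hγ)
    ⟨M + M, fun t => (norm_sub_le _ _).trans (add_le_add (hM _) (hM _))⟩

lemma HasMarchaudDeriv.sub (hα : 0 < α) {γ₁ γ₂ : ℝ → H} (h₁ : Continuous γ₁)
    (hM₁ : ∃ M, ∀ t, ‖γ₁ t‖ ≤ M) (h₂ : Continuous γ₂) (hM₂ : ∃ M, ∀ t, ‖γ₂ t‖ ≤ M) {G₁ G₂ : H}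
    (hG₁ : HasMarchaudDeriv α γ₁ G₁) (hG₂ : HasMarchaudDeriv α γ₂ G₂) :
    HasMarchaudDeriv α (γ₁ - γ₂) (G₁ - G₂) := by
  refine (Tendsto.sub hG₁ hG₂).congr' ?_
  filter_upwards [self_mem_nhdsWithin] with ε hε
  rw [marchaud, marchaud, marchaud, ← integral_sub (integrable_marchaud hα hε h₁ hM₁)
    (integrable_marchaud hα hε h₂ hM₂)]
  congr 1 with t
  simp only [Pi.sub_apply]
  module

variable [CompleteSpace H]

lemma inner_marchaud (hα : 0 < α) (hε : 0 < ε) {γ : ℝ → H} (hγ : Continuous γ)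
    (hM : ∃ M, ∀ t, ‖γ t‖ ≤ M) (v : H) :
    inner ℝ v (marchaud α γ ε) = ∫ t, marchaudKernel α ε t * inner ℝ v (γ 0 - γ t) ∂halfLine := by
  rw [marchaud, ← integral_inner (integrable_marchaud hα hε hγ hM)]
  simp only [inner_smul_right]

lemma inner_marchaud_marchaud (hα : 0 < α) (hε : 0 < ε) (hδ : 0 < δ) {γ₁ γ₂ : ℝ → H}
    (h₁ : Continuous γ₁) (hM₁ : ∃ M, ∀ t, ‖γ₁ t‖ ≤ M) (h₂ : Continuous γ₂)
    (hM₂ : ∃ M, ∀ t, ‖γ₂ t‖ ≤ M) :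
    inner ℝ (marchaud α γ₁ ε) (marchaud α γ₂ δ)
      = ∫ p, marchaudKernel α ε p.1 * marchaudKernel α δ p.2 *
          inner ℝ (γ₁ 0 - γ₁ p.1) (γ₂ 0 - γ₂ p.2) ∂(halfLine.prod halfLine) := by
  have hbounded : ∃ M, ∀ p : ℝ × ℝ, ‖inner ℝ (γ₁ 0 - γ₁ p.1) (γ₂ 0 - γ₂ p.2)‖ ≤ M := by
    obtain ⟨M₁, hM₁⟩ := hM₁
    obtain ⟨M₂, hM₂⟩ := hM₂
    refine ⟨(M₁ + M₁) * (M₂ + M₂), fun p => (norm_inner_le_norm _ _).trans ?_⟩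
    have hb₁ := (norm_sub_le (γ₁ 0) (γ₁ p.1)).trans (add_le_add (hM₁ _) (hM₁ _))
    have hb₂ := (norm_sub_le (γ₂ 0) (γ₂ p.2)).trans (add_le_add (hM₂ _) (hM₂ _))
    exact mul_le_mul hb₁ hb₂ (norm_nonneg _) ((norm_nonneg _).trans hb₁)
  rw [integral_prod _ (integrable_marchaudKernel_mul_mul hα hε hδ (by fun_prop) hbounded),
    real_inner_comm, inner_marchaud hα hε h₁ hM₁]
  congr 1 with t
  rw [real_inner_comm, inner_marchaud hα hδ h₂ hM₂, ← integral_const_mul]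
  simp only [mul_assoc]

lemma HasMarchaudDeriv.inner_eq_zero (hα : 0 < α) {γ : ℝ → H} (hγ : Continuous γ)
    (hM : ∃ M, ∀ t, ‖γ t‖ ≤ M) {G v : H} (hG : HasMarchaudDeriv α γ G)
    (hv : ∀ t, 0 < t → inner ℝ v (γ 0 - γ t) = 0) : inner ℝ v G = 0 := by
  refine tendsto_nhds_unique (tendsto_const_nhds.inner hG) (tendsto_const_nhds.congr' ?_)
  filter_upwards [self_mem_nhdsWithin] with ε hε
  rw [inner_marchaud hα hε hγ hM, setIntegral_eq_zero_of_forall_eq_zero fun t ht => ?_]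
  rw [hv t ht, mul_zero]

end Marchaud

section StationaryCurve

variable {H : Type*} [NormedAddCommGroup H] {γ : ℝ → H} {w : ℝ → ℝ}

/-- A bounded continuous curve whose increments are stationary, with squared norm `w`. -/
structure IsStationaryCurve (γ : ℝ → H) (w : ℝ → ℝ) : Prop where
  continuous : Continuous γ
  bounded : ∃ M, ∀ t, ‖γ t‖ ≤ M
  norm_sub_sq : ∀ a b, ‖γ a - γ b‖ ^ 2 = w (a - b)

namespace IsStationaryCurve

lemma incr_eq (hγ : IsStationaryCurve γ w) (t : ℝ) : w t = ‖γ t - γ 0‖ ^ 2 := by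
  rw [hγ.norm_sub_sq, sub_zero]

lemma incr_nonneg (hγ : IsStationaryCurve γ w) (t : ℝ) : 0 ≤ w t := by
  rw [hγ.incr_eq]
  positivity

lemma incr_neg (hγ : IsStationaryCurve γ w) (t : ℝ) : w (-t) = w t := by
  rw [hγ.incr_eq t, norm_sub_rev, hγ.norm_sub_sq, zero_sub]

lemma continuous_incr (hγ : IsStationaryCurve γ w) : Continuous w := by
  have hc := hγ.continuous
  rw [funext hγ.incr_eq]
  fun_prop

lemma bounded_incr (hγ : IsStationaryCurve γ w) : ∃ M, ∀ t, ‖w t‖ ≤ M := by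
  obtain ⟨M, hM⟩ := hγ.bounded
  refine ⟨(M + M) ^ 2, fun t => ?_⟩
  rw [Real.norm_of_nonneg (hγ.incr_nonneg t), hγ.incr_eq]
  gcongr
  exact (norm_sub_le _ _).trans (add_le_add (hM _) (hM _))

lemma comp_neg (hγ : IsStationaryCurve γ w) : IsStationaryCurve (fun t => γ (-t)) w where
  continuous := hγ.continuous.comp continuous_neg
  bounded := hγ.bounded.imp fun _ h t => h (-t)
  norm_sub_sq a b := by
    rw [hγ.norm_sub_sq, ← hγ.incr_neg]
    ring_nf

variable [InnerProductSpace ℝ H]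

lemma inner_sub_sub (hγ : IsStationaryCurve γ w) (t τ : ℝ) :
    inner ℝ (γ 0 - γ t) (γ 0 - γ τ) = (w t + w τ - w (t - τ)) / 2 := by
  have h := norm_sub_sq_real (γ 0 - γ t) (γ 0 - γ τ)
  rw [sub_sub_sub_cancel_left, norm_sub_rev, hγ.norm_sub_sq, norm_sub_rev (γ 0) (γ t),
    norm_sub_rev (γ 0) (γ τ), ← hγ.incr_eq, ← hγ.incr_eq] at h
  linarith

end IsStationaryCurve

/-- One of the two symmetric parts of `2 * ⟪marchaud α γ ε, marchaud α γ δ⟫` for a curve `γ` with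
stationary increments of squared norm `w`. -/
def incrForm (α : ℝ) (w : ℝ → ℝ) (ε δ : ℝ) : ℝ :=
  ∫ p, w p.2 * incrKernel α ε δ p ∂(halfLine.prod halfLine)

section IncrForm

variable {α ε δ : ℝ}

lemma incrForm_eq_sub (hα : 0 < α) (hε : 0 < ε) (hδ : 0 < δ) (hw : Continuous w)
    (hM : ∃ M, ∀ t, ‖w t‖ ≤ M) :
    incrForm α w ε δ = δ ^ (-α) * (∫ h, w h * marchaudKernel α ε h ∂halfLine)
      - ∫ p in triangle, marchaudKernel α ε p.2 * marchaudKernel α δ p.1 * w (p.2 - p.1) := by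
  have hdiag : Integrable (fun p : ℝ × ℝ => marchaudKernel α δ p.1 * marchaudKernel α ε p.2 * w p.2)
      (halfLine.prod halfLine) :=
    integrable_marchaudKernel_mul_mul hα hδ hε (hw.comp continuous_snd)
      (hM.imp fun _ h p => h p.2)
  have hoff : Integrable (fun p : ℝ × ℝ => marchaudKernel α ε p.1 * marchaudKernel α δ p.2
      * w (p.1 - p.2)) (halfLine.prod halfLine) :=
    integrable_marchaudKernel_mul_mul hα hε hδ (hw.comp (continuous_fst.sub continuous_snd))
      (hM.imp fun _ h p => h (p.1 - p.2))
  have hsheared : Integrable (fun p : ℝ × ℝ => marchaudKernel α ε (p.1 + p.2)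
      * marchaudKernel α δ p.1 * w (p.1 + p.2 - p.1)) (halfLine.prod halfLine) :=
    integrable_shear hoff.swap
  rw [setIntegral_triangle_eq, ← integral_marchaudKernel_mul_mul_snd hα hδ,
    ← integral_sub hdiag hsheared, incrForm]
  congr 1 with p
  rw [incrKernel, add_sub_cancel_left]
  ring

lemma integral_marchaudKernel_mul_incr_sub (hα : 0 < α) (hε : 0 < ε) (hδ : 0 < δ)
    (hw : Continuous w) (hM : ∃ M, ∀ t, ‖w t‖ ≤ M) (heven : ∀ t, w (-t) = w t) :
    ∫ p : ℝ × ℝ, marchaudKernel α ε p.1 * marchaudKernel α δ p.2 * w (p.1 - p.2)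
        ∂(halfLine.prod halfLine)
      = (∫ p in triangle, marchaudKernel α δ p.2 * marchaudKernel α ε p.1 * w (p.2 - p.1))
        + ∫ p in triangle, marchaudKernel α ε p.2 * marchaudKernel α δ p.1 * w (p.2 - p.1) := by
  have hi : Integrable (fun p : ℝ × ℝ => marchaudKernel α ε p.1 * marchaudKernel α δ p.2
      * w (p.1 - p.2)) (halfLine.prod halfLine) :=
    integrable_marchaudKernel_mul_mul hα hε hδ (hw.comp (continuous_fst.sub continuous_snd))
      (hM.imp fun _ h p => h (p.1 - p.2))
  rw [integral_quadrant_eq_triangle_add hi]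
  congr 2 with p
  rw [← heven, neg_sub]
  ring

lemma tendsto_incrForm (hα : 0 < α) (hα1 : α < 1) (hw : Measurable w) (hw0 : ∀ h, 0 ≤ w h)
    (hi : Integrable (fun h => w h * h ^ (-1 - 2 * α)) halfLine) :
    Tendsto (fun q : ℝ × ℝ => incrForm α w q.1 q.2) (𝓝[>] 0 ×ˢ 𝓝[>] 0)
      (𝓝 (incrForm α w 0 0)) := by
  have hpos : ∀ᶠ q : ℝ × ℝ in 𝓝[>] (0 : ℝ) ×ˢ 𝓝[>] (0 : ℝ), 0 < q.1 ∧ 0 < q.2 :=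
    Filter.Eventually.prod_mk self_mem_nhdsWithin self_mem_nhdsWithin
  refine tendsto_integral_filter_of_dominated_convergence
    (fun p => w p.2 * incrKernel α 0 0 p) (Eventually.of_forall fun q =>
      ((hw.comp measurable_snd).mul (measurable_incrKernel α q.1 q.2)).aestronglyMeasurable) ?_
    (integrable_mul_incrKernel_zero hα hα1 hw hi) ?_
  · filter_upwards [hpos] with q hq
    filter_upwards [ae_halfLine_prod] with p hp
    rw [Real.norm_of_nonneg
      (mul_nonneg (hw0 _) (incrKernel_nonneg hα.le hq.1.le hq.2.le hp.1 hp.2))]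
    exact mul_le_mul_of_nonneg_left
      (incrKernel_le_incrKernel_zero hα.le hq.1.le hq.2.le hp.1 hp.2) (hw0 _)
  · filter_upwards [ae_halfLine_prod] with p hp
    refine Tendsto.const_mul _ (Tendsto.mul (Tendsto.sub ?_ ?_) ?_)
    · exact (tendsto_marchaudKernel hp.2).comp tendsto_fst
    · exact (tendsto_marchaudKernel (add_pos hp.1 hp.2)).comp tendsto_fst
    · exact (tendsto_marchaudKernel hp.1).comp tendsto_snd

end IncrForm

variable [InnerProductSpace ℝ H] [CompleteSpace H]

lemma IsStationaryCurve.inner_marchaud_self (hγ : IsStationaryCurve γ w) {α ε δ : ℝ} (hα : 0 < α)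
    (hε : 0 < ε) (hδ : 0 < δ) :
    inner ℝ (marchaud α γ ε) (marchaud α γ δ)
      = (incrForm α w ε δ + incrForm α w δ ε) / 2 := by
  have hw := hγ.continuous_incr
  have hM := hγ.bounded_incr
  rw [inner_marchaud_marchaud hα hε hδ hγ.continuous hγ.bounded hγ.continuous hγ.bounded]
  simp only [hγ.inner_sub_sub]
  rw [integral_marchaudKernel_mul_half hα hε hδ hw hM (σ := fun p => p.1 - p.2) (by fun_prop),
    integral_marchaudKernel_mul_incr_sub hα hε hδ hw hM hγ.incr_neg,
    incrForm_eq_sub hα hε hδ hw hM, incrForm_eq_sub hα hδ hε hw hM]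
  ring

lemma exists_tendsto_of_tendsto_inner {ι : Type*} {l : Filter ι} [l.NeBot] {f : ι → H} {N : ℝ}
    (h : Tendsto (fun q : ι × ι => (inner ℝ (f q.1) (f q.2) : ℝ)) (l ×ˢ l) (𝓝 N)) :
    ∃ G : H, Tendsto f l (𝓝 G) := by
  rw [← cauchy_map_iff_exists_tendsto, cauchy_map_iff, tendsto_uniformity_iff_dist_tendsto_zero]
  refine ⟨inferInstance, ?_⟩
  have hfst : Tendsto (fun q : ι × ι => (inner ℝ (f q.1) (f q.1) : ℝ)) (l ×ˢ l) (𝓝 N) :=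
    h.comp (tendsto_fst.prodMk tendsto_fst)
  have hsnd : Tendsto (fun q : ι × ι => (inner ℝ (f q.2) (f q.2) : ℝ)) (l ×ˢ l) (𝓝 N) :=
    h.comp (tendsto_snd.prodMk tendsto_snd)
  have hsq : Tendsto (fun q : ι × ι => ‖f q.1 - f q.2‖ ^ 2) (l ×ˢ l) (𝓝 0) := by
    have hexpand := (hfst.sub (h.const_mul 2)).add hsnd
    rw [show N - 2 * N + N = 0 by ring] at hexpand
    refine hexpand.congr fun q => ?_
    rw [norm_sub_sq_real, real_inner_self_eq_norm_sq, real_inner_self_eq_norm_sq]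
  have hsqrt := hsq.sqrt
  simp only [Real.sqrt_zero, Real.sqrt_sq (norm_nonneg _)] at hsqrt
  simpa only [dist_eq_norm] using hsqrt

theorem IsStationaryCurve.exists_hasMarchaudDeriv (hγ : IsStationaryCurve γ w) {α : ℝ}
    (hα : 0 < α) (hα1 : α < 1) (hi : Integrable (fun h => w h * h ^ (-1 - 2 * α)) halfLine) :
    ∃ G : H, HasMarchaudDeriv α γ G := by
  have hlim := tendsto_incrForm hα hα1 hγ.continuous_incr.measurable hγ.incr_nonneg hi
  have hpos : ∀ᶠ q : ℝ × ℝ in 𝓝[>] (0 : ℝ) ×ˢ 𝓝[>] (0 : ℝ), 0 < q.1 ∧ 0 < q.2 :=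
    Filter.Eventually.prod_mk self_mem_nhdsWithin self_mem_nhdsWithin
  refine exists_tendsto_of_tendsto_inner
    (((hlim.add (hlim.comp (tendsto_snd.prodMk tendsto_fst))).div_const 2).congr' ?_)
  filter_upwards [hpos] with q hq
  exact (hγ.inner_marchaud_self hα hq.1 hq.2).symm

end StationaryCurve

section MixedForm

variable {H : Type*} [NormedAddCommGroup H] {γ : ℝ → H} {w : ℝ → ℝ} {α ε : ℝ}

lemma integrableOn_triangle_marchaudKernel_mul (hα : 0 < α) (hε : 0 < ε) (hw : Continuous w)
    (hM : ∃ M, ∀ t, ‖w t‖ ≤ M) :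
    IntegrableOn (fun p => marchaudKernel α ε p.1 * marchaudKernel α ε (p.2 - p.1) * w p.2)
      triangle := by
  rw [integrableOn_triangle_iff]
  simp only [add_sub_cancel_left]
  exact integrable_marchaudKernel_mul_mul hα hε hε (hw.comp (continuous_fst.add continuous_snd))
    (hM.imp fun _ h p => h (p.1 + p.2))

lemma mul_mixedKernel_eq (α ε h : ℝ) (w : ℝ → ℝ) :
    w h * mixedKernel α ε h
      = (∫ t in 0..h, marchaudKernel α ε t * marchaudKernel α ε (h - t) * w h)
        - 2 * ε ^ (-α) * (w h * marchaudKernel α ε h) := by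
  rw [intervalIntegral.integral_mul_const, mixedKernel]
  ring

lemma integrable_mul_marchaudKernel (hα : 0 < α) (hε : 0 < ε) (hw : Continuous w)
    (hM : ∃ M, ∀ t, ‖w t‖ ≤ M) : Integrable (fun h => w h * marchaudKernel α ε h) halfLine := by
  simpa only [smul_eq_mul, mul_comm] using integrable_marchaudKernel_smul hα hε hw hM

lemma integrable_mul_mixedKernel (hα : 0 < α) (hε : 0 < ε) (hw : Continuous w)
    (hM : ∃ M, ∀ t, ‖w t‖ ≤ M) : Integrable (fun h => w h * mixedKernel α ε h) halfLine := by
  simp only [mul_mixedKernel_eq]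
  exact (integrable_integral_triangle (integrableOn_triangle_marchaudKernel_mul hα hε hw hM)).sub
    ((integrable_mul_marchaudKernel hα hε hw hM).const_mul _)

lemma integral_mul_mixedKernel (hα : 0 < α) (hε : 0 < ε) (hw : Continuous w)
    (hM : ∃ M, ∀ t, ‖w t‖ ≤ M) :
    ∫ h, w h * mixedKernel α ε h ∂halfLine
      = (∫ p : ℝ × ℝ, marchaudKernel α ε p.1 * marchaudKernel α ε p.2 * w (p.1 + p.2)
          ∂(halfLine.prod halfLine))
        - 2 * ε ^ (-α) * ∫ h, w h * marchaudKernel α ε h ∂halfLine := by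
  have htri := integrableOn_triangle_marchaudKernel_mul hα hε hw hM
  simp only [mul_mixedKernel_eq]
  rw [integral_sub (integrable_integral_triangle htri)
    ((integrable_mul_marchaudKernel hα hε hw hM).const_mul _), integral_const_mul,
    ← setIntegral_triangle_eq_integral htri, setIntegral_triangle_eq]
  simp only [add_sub_cancel_left]

lemma norm_mul_mixedMinorant_le (hα : 1 / 2 ≤ α) (hα1 : α ≤ 1) (hε : 0 < ε) (hw : ∀ t, 0 ≤ w t)
    {h : ℝ} (hh : 0 < h) :
    ‖w h * mixedMinorant α ε h‖
      ≤ (2 * α * (2 * α - 1) * 4 ^ α + 8 * α) * (w h * h ^ (-1 - 2 * α)) := by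
  rw [norm_mul, Real.norm_of_nonneg (hw h), mul_left_comm]
  exact mul_le_mul_of_nonneg_left (abs_mixedMinorant_le hα hα1 hε hh) (hw h)

lemma integrable_mul_mixedMinorant (hα : 1 / 2 ≤ α) (hα1 : α ≤ 1) (hε : 0 < ε)
    (hwm : Measurable w) (hw : ∀ t, 0 ≤ w t)
    (hi : Integrable (fun h => w h * h ^ (-1 - 2 * α)) halfLine) :
    Integrable (fun h => w h * mixedMinorant α ε h) halfLine := by
  refine (hi.const_mul (2 * α * (2 * α - 1) * 4 ^ α + 8 * α)).mono'
    (hwm.mul (measurable_mixedMinorant α ε)).aestronglyMeasurable ?_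
  filter_upwards [ae_restrict_mem measurableSet_Ioi] with h hh
  exact norm_mul_mixedMinorant_le hα hα1 hε hw hh

lemma tendsto_integral_mul_mixedMinorant (hα : 1 / 2 ≤ α) (hα1 : α < 1) (hwm : Measurable w)
    (hw : ∀ t, 0 ≤ w t) (hi : Integrable (fun h => w h * h ^ (-1 - 2 * α)) halfLine) :
    Tendsto (fun ε => ∫ h, w h * mixedMinorant α ε h ∂halfLine) (𝓝[>] 0)
      (𝓝 (2 * α * (2 * α - 1) * 4 ^ α * ∫ h, w h * h ^ (-1 - 2 * α) ∂halfLine)) := by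
  rw [← integral_const_mul]
  refine tendsto_integral_filter_of_dominated_convergence
    (fun h => (2 * α * (2 * α - 1) * 4 ^ α + 8 * α) * (w h * h ^ (-1 - 2 * α)))
    (Eventually.of_forall fun ε =>
      (hwm.mul (measurable_mixedMinorant α ε)).aestronglyMeasurable) ?_ (hi.const_mul _) ?_
  · filter_upwards [self_mem_nhdsWithin] with ε hε
    filter_upwards [ae_restrict_mem measurableSet_Ioi] with h hh
    exact norm_mul_mixedMinorant_le hα hα1.le hε hw hh
  · filter_upwards [ae_restrict_mem measurableSet_Ioi] with h hh
    rw [mul_left_comm]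
    exact (tendsto_mixedMinorant hα1 hh).const_mul _

variable [InnerProductSpace ℝ H] [CompleteSpace H]

lemma IsStationaryCurve.neg_inner_marchaud_comp_neg (hγ : IsStationaryCurve γ w) (hα : 0 < α)
    (hε : 0 < ε) :
    -inner ℝ (marchaud α γ ε) (marchaud α (fun t => γ (-t)) ε)
      = (∫ h, w h * mixedKernel α ε h ∂halfLine) / 2 := by
  have hw := hγ.continuous_incr
  have hM := hγ.bounded_incr
  have hinner (p : ℝ × ℝ) : inner ℝ (γ 0 - γ p.1) (γ (-0) - γ (-p.2))
      = (w p.1 + w p.2 - w (p.1 + p.2)) / 2 := by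
    rw [neg_zero, hγ.inner_sub_sub, hγ.incr_neg, sub_neg_eq_add]
  rw [inner_marchaud_marchaud hα hε hε hγ.continuous hγ.bounded hγ.comp_neg.continuous
    hγ.comp_neg.bounded]
  simp only [hinner]
  rw [integral_marchaudKernel_mul_half hα hε hε hw hM (σ := fun p => p.1 + p.2) (by fun_prop),
    integral_mul_mixedKernel hα hε hw hM]
  ring

theorem HasMarchaudDeriv.le_neg_inner (hγ : IsStationaryCurve γ w) (hα : 1 / 2 ≤ α) (hα1 : α < 1)
    (hi : Integrable (fun h => w h * h ^ (-1 - 2 * α)) halfLine) {G G' : H}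
    (hG : HasMarchaudDeriv α γ G) (hG' : HasMarchaudDeriv α (fun t => γ (-t)) G') :
    α * (2 * α - 1) * 4 ^ α * (∫ h, w h * h ^ (-1 - 2 * α) ∂halfLine) ≤ -inner ℝ G G' := by
  have hw := hγ.continuous_incr
  have hlim :=
    (tendsto_integral_mul_mixedMinorant hα hα1 hw.measurable hγ.incr_nonneg hi).div_const 2
  refine le_of_eq_of_le (by ring) (le_of_tendsto_of_tendsto hlim (Tendsto.inner hG hG').neg ?_)
  filter_upwards [self_mem_nhdsWithin] with ε hε
  rw [hγ.neg_inner_marchaud_comp_neg (by linarith) hε]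
  refine div_le_div_of_nonneg_right (integral_mono_ae
    (integrable_mul_mixedMinorant hα hα1.le hε hw.measurable hγ.incr_nonneg hi)
    (integrable_mul_mixedKernel (by linarith) hε hw hγ.bounded_incr) ?_) zero_le_two
  filter_upwards [ae_restrict_mem measurableSet_Ioi] with h hh
  exact mul_le_mul_of_nonneg_left (mixedMinorant_le_mixedKernel hα hε hh.le) (hγ.incr_nonneg h)

end MixedForm

section RealL2

variable {X : Type*} [MeasurableSpace X] {μ : Measure X}

lemma inner_toLp_left {φ : X → ℝ} (hφ : MemLp φ 2 μ) (G : Lp ℝ 2 μ) :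
    inner ℝ (hφ.toLp φ) G = ∫ x, G x * φ x ∂μ := by
  rw [L2.inner_def]
  refine integral_congr_ae ?_
  filter_upwards [hφ.coeFn_toLp] with x hx
  rw [hx, RCLike.inner_apply, conj_trivial]

lemma HasMarchaudDeriv.ae_eq_zero {α : ℝ} (hα : 0 < α) {γ : ℝ → Lp ℝ 2 μ} (hγ : Continuous γ)
    (hM : ∃ M, ∀ t, ‖γ t‖ ≤ M) {G : Lp ℝ 2 μ} (hG : HasMarchaudDeriv α γ G) {S : Set X}
    (hS : MeasurableSet S) (hconst : ∀ t, 0 < t → ∀ᵐ x ∂μ, x ∈ S → γ t x = γ 0 x) :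
    ∀ᵐ x ∂μ, x ∈ S → G x = 0 := by
  have hGS : MemLp (S.indicator G) 2 μ := (Lp.memLp G).indicator hS
  have horth : inner ℝ (hGS.toLp _) G = 0 := by
    refine hG.inner_eq_zero hα hγ hM fun t ht => ?_
    rw [inner_toLp_left]
    refine integral_eq_zero_of_ae ?_
    filter_upwards [hconst t ht, Lp.coeFn_sub (γ 0) (γ t)] with x hx hsub
    by_cases hxS : x ∈ S
    · rw [hsub, Pi.sub_apply, hx hxS, sub_self, zero_mul, Pi.zero_apply]
    · simp [hxS]
  have hsq (x : X) : G x * S.indicator G x = S.indicator G x ^ 2 := by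
    by_cases hxS : x ∈ S <;> simp [hxS, sq]
  rw [inner_toLp_left] at horth
  simp only [hsq] at horth
  rw [integral_eq_zero_iff_of_nonneg (fun x => sq_nonneg _) hGS.integrable_sq] at horth
  filter_upwards [horth] with x hx hxS
  simpa [hxS] using hx

end RealL2

section Translation

/-- The Hilbert space `L²(ℝ)`. -/
abbrev LineL2 : Type := Lp ℝ 2 (volume : Measure ℝ)

/-- Translation by `t` on `L²(ℝ)`. -/
def translate (t : ℝ) : LineL2 →ₗᵢ[ℝ] LineL2 :=
  Lp.compMeasurePreservingₗᵢ ℝ (· - t) (measurePreserving_sub_right volume t)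

/-- The translates of `f` as a curve in `L²(ℝ)`, moving to the right for `σ = 1` and to the left for
`σ = -1`. -/
def translateCurve (σ : ℝ) (f : LineL2) (t : ℝ) : LineL2 := translate (σ * t) f

/-- The squared `L²` norm of the increments of `f`. -/
def incr (f : LineL2) (h : ℝ) : ℝ := ‖translate h f - f‖ ^ 2

variable {σ : ℝ}

lemma coeFn_translate (t : ℝ) (f : LineL2) : translate t f =ᵐ[volume] fun x => f (x - t) :=
  Lp.coeFn_compMeasurePreserving f _

lemma translate_toLp {u : ℝ → ℝ} (hu : MemLp u 2 volume) (t : ℝ) :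
    translate t (hu.toLp u)
      = (hu.comp_measurePreserving (measurePreserving_sub_right volume t)).toLp _ :=
  rfl

lemma translate_add (s t : ℝ) (f : LineL2) : translate (s + t) f = translate s (translate t f) := by
  refine Lp.ext ?_
  have hshift := (measurePreserving_sub_right volume s).quasiMeasurePreserving.ae_eq_comp
    (coeFn_translate t f)
  filter_upwards [coeFn_translate (s + t) f, coeFn_translate s (translate t f), hshift]
    with x h₁ h₂ h₃
  rw [h₁, h₂, ← sub_sub]
  exact h₃.symm

lemma continuous_translate (f : LineL2) : Continuous fun t => translate t f := by
  let shift : C(ℝ, C(ℝ, ℝ)) := (ContinuousMap.mk (fun p : ℝ × ℝ => p.2 - p.1) (by fun_prop)).curry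
  exact (continuous_const (y := f)).compMeasurePreservingLp shift.continuous
    (fun t => measurePreserving_sub_right volume t) (by simp)

lemma norm_translate_sub_translate_sq (f : LineL2) (a b : ℝ) :
    ‖translate a f - translate b f‖ ^ 2 = incr f (a - b) := by
  rw [incr, ← (translate b).norm_map (translate (a - b) f - f), map_sub, ← translate_add,
    add_sub_cancel]

lemma translate_zero (f : LineL2) : translate 0 f = f := by
  refine Lp.ext ?_
  filter_upwards [coeFn_translate 0 f] with x hx
  rw [hx, sub_zero]

lemma incr_neg (f : LineL2) (h : ℝ) : incr f (-h) = incr f h := by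
  rw [← zero_sub, ← norm_translate_sub_translate_sq, norm_sub_rev, translate_zero, incr]

lemma incr_abs (f : LineL2) (h : ℝ) : incr f |h| = incr f h := by
  rcases abs_choice h with habs | habs <;> rw [habs]
  exact incr_neg f h

lemma incr_toLp {u : ℝ → ℝ} (hu : MemLp u 2 volume) (h : ℝ) :
    incr (hu.toLp u) h = ∫ x, (u (x - h) - u x) ^ 2 := by
  rw [incr, translate_toLp, ← MemLp.toLp_sub, ← real_inner_self_eq_norm_sq, inner_toLp_left]
  refine integral_congr_ae ?_
  filter_upwards [((hu.comp_measurePreserving (measurePreserving_sub_right volume h)).sub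
    hu).coeFn_toLp] with x hx
  rw [hx, ← sq]
  rfl

lemma isStationaryCurve_translateCurve (hσ : |σ| = 1) (f : LineL2) :
    IsStationaryCurve (translateCurve σ f) (incr f) where
  continuous := (continuous_translate f).comp (continuous_const_mul σ)
  bounded := ⟨‖f‖, fun t => ((translate (σ * t)).norm_map f).le⟩
  norm_sub_sq a b := by
    rw [translateCurve, translateCurve, norm_translate_sub_translate_sq, ← mul_sub, ← incr_abs,
      abs_mul, hσ, one_mul, incr_abs]

lemma translateCurve_sub (σ : ℝ) (f g : LineL2) :
    translateCurve σ (f - g) = translateCurve σ f - translateCurve σ g :=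
  funext fun _ => map_sub _ _ _

lemma translateCurve_one_neg (f : LineL2) :
    (fun t => translateCurve 1 f (-t)) = translateCurve (-1) f := by
  funext t
  simp only [translateCurve, one_mul, neg_mul]

end Translation

section Correlation

variable {u φ : ℝ → ℝ}

/-- The correlation of `u` with `φ`: the pairing of the translates of `u` with `φ`. -/
def correlation (u φ : ℝ → ℝ) (t : ℝ) : ℝ := ∫ x, u (x - t) * φ x

lemma correlation_eq_convolution (u φ : ℝ → ℝ) :
    correlation u φ = convolution (fun y => u (-y)) φ (ContinuousLinearMap.mul ℝ ℝ) volume := by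
  funext t
  simp only [convolution_mul_swap, neg_sub, correlation]

lemma inner_translate_toLp (hu : MemLp u 2 volume) (hφ : MemLp φ 2 volume) (t : ℝ) :
    inner ℝ (hφ.toLp φ) (translate t (hu.toLp u)) = correlation u φ t := by
  rw [inner_toLp_left, translate_toLp]
  refine integral_congr_ae ?_
  filter_upwards [(hu.comp_measurePreserving (measurePreserving_sub_right volume t)).coeFn_toLp]
    with x hx
  rw [hx, Function.comp_apply]

lemma hasDerivAt_correlation (hu : Integrable u) (hφ : ContDiff ℝ 1 φ)
    (hc : HasCompactSupport φ) (t : ℝ) :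
    HasDerivAt (correlation u φ) (correlation u (deriv φ) t) t := by
  rw [correlation_eq_convolution, correlation_eq_convolution]
  exact hc.hasDerivAt_convolution_right _ hu.comp_neg.locallyIntegrable hφ t

lemma continuous_correlation (hu : Integrable u) (hφ : Continuous φ)
    (hc : HasCompactSupport φ) : Continuous (correlation u φ) := by
  rw [correlation_eq_convolution]
  exact hc.continuous_convolution_right _ hu.comp_neg.locallyIntegrable hφ

lemma integral_convolution_mul {k : ℝ → ℝ} (hk : Integrable k) (hu : Integrable u)
    (hφ : Continuous φ) (hc : HasCompactSupport φ) :
    ∫ x, convolution k u (ContinuousLinearMap.mul ℝ ℝ) volume x * φ x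
      = ∫ t, k t * correlation u φ t := by
  obtain ⟨M, hM⟩ := hc.exists_bound_of_continuous hφ
  have hi : Integrable (fun p : ℝ × ℝ => k p.2 * u (p.1 - p.2) * φ p.1) (volume.prod volume) :=
    (hk.convolution_integrand (ContinuousLinearMap.mul ℝ ℝ) hu).mul_bdd
      (hφ.comp continuous_fst).aestronglyMeasurable (Eventually.of_forall fun p => hM p.1)
  calc ∫ x, convolution k u (ContinuousLinearMap.mul ℝ ℝ) volume x * φ x
      = ∫ x, ∫ t, k t * u (x - t) * φ x := by simp only [integral_mul_const]; rfl
    _ = ∫ t, ∫ x, k t * u (x - t) * φ x := integral_integral_swap hi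
    _ = ∫ t, k t * correlation u φ t := by
      simp only [mul_assoc, integral_const_mul, correlation]

lemma ae_translate_eq_zero (hu : ∀ᵐ x, x ∉ Omega → u x = 0) (t : ℝ) :
    ∀ᵐ x, x - t ∉ Omega → u (x - t) = 0 :=
  (measurePreserving_sub_right volume t).quasiMeasurePreserving.ae hu

lemma correlation_eq_zero (hu : ∀ᵐ x, x ∉ Omega → u x = 0) (hφ : ∀ x ∉ Omega, φ x = 0) {t : ℝ}
    (ht : 1 ≤ |t|) : correlation u φ t = 0 := by
  refine integral_eq_zero_of_ae ?_
  filter_upwards [ae_translate_eq_zero hu t] with x hx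
  by_cases hxΩ : x ∈ Omega
  · have hxt : x - t ∉ Omega := fun hxt =>
      ht.not_gt (abs_lt.2 ⟨by linarith [hxΩ.1, hxt.2], by linarith [hxΩ.2, hxt.1]⟩)
    simp [hx hxt]
  · simp [hφ x hxΩ]

end Correlation

section WeakPairing

variable {α ε : ℝ} {r r' : ℝ → ℝ}

lemma hasDerivAt_neg_add_rpow {t : ℝ} (ht : 0 < t + ε) :
    HasDerivAt (fun t => -(t + ε) ^ (-α)) (marchaudKernel α ε t) t := by
  refine (((hasDerivAt_id t).add_const ε).rpow_const (p := -α) (Or.inl ht.ne')).neg.congr_deriv ?_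
  rw [marchaudKernel, id, neg_sub_left, ← neg_add']
  ring

lemma norm_add_rpow_mul_le (hα : 0 ≤ α) (hε : 0 ≤ ε) {t : ℝ} (ht : 0 < t) (x : ℝ) :
    ‖(t + ε) ^ (-α) * x‖ ≤ ‖t ^ (-α) * x‖ := by
  have hpow : (t + ε) ^ (-α) ≤ t ^ (-α) :=
    Real.rpow_le_rpow_of_nonpos ht (by linarith) (by linarith)
  rw [norm_mul, norm_mul, Real.norm_of_nonneg (by positivity : 0 ≤ (t + ε) ^ (-α)),
    Real.norm_of_nonneg (by positivity : 0 ≤ t ^ (-α))]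
  gcongr

lemma measurable_add_rpow_mul (hr' : Measurable r') (α ε : ℝ) :
    Measurable fun t => (t + ε) ^ (-α) * r' t := by
  fun_prop

lemma integrable_add_rpow_mul (hα : 0 ≤ α) (hε : 0 ≤ ε) (hr' : Measurable r')
    (hi : Integrable (fun t => t ^ (-α) * r' t) halfLine) :
    Integrable (fun t => (t + ε) ^ (-α) * r' t) halfLine := by
  refine hi.mono (measurable_add_rpow_mul hr' α ε).aestronglyMeasurable ?_
  filter_upwards [ae_restrict_mem measurableSet_Ioi] with t ht
  exact norm_add_rpow_mul_le hα hε ht (r' t)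

lemma tendsto_integral_add_rpow_mul (hα : 0 ≤ α) (hr' : Measurable r')
    (hi : Integrable (fun t => t ^ (-α) * r' t) halfLine) :
    Tendsto (fun ε => ∫ t, (t + ε) ^ (-α) * r' t ∂halfLine) (𝓝[>] 0)
      (𝓝 (∫ t, t ^ (-α) * r' t ∂halfLine)) := by
  refine tendsto_integral_filter_of_dominated_convergence _
    (Eventually.of_forall fun ε => (measurable_add_rpow_mul hr' α ε).aestronglyMeasurable) ?_
    hi.norm ?_
  · filter_upwards [self_mem_nhdsWithin] with ε hε
    filter_upwards [ae_restrict_mem measurableSet_Ioi] with t ht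
    exact norm_add_rpow_mul_le hα (le_of_lt hε) ht (r' t)
  · filter_upwards [ae_restrict_mem measurableSet_Ioi] with t ht
    have hcont : ContinuousAt (fun ε => (t + ε) ^ (-α) * r' t) 0 := by
      refine (ContinuousAt.rpow_const (by fun_prop) (Or.inl ?_)).mul_const _
      simpa using (mem_Ioi.1 ht).ne'
    simpa using hcont.tendsto.mono_left nhdsWithin_le_nhds

lemma measurable_of_hasDerivAt (hr : ∀ t, HasDerivAt r (r' t) t) : Measurable r' := by
  rw [← funext fun t => (hr t).deriv]
  exact measurable_deriv r

lemma integral_marchaudKernel_mul_sub (hα : 0 < α) (hε : 0 < ε)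
    (hr : ∀ t, HasDerivAt r (r' t) t) (hb : ∃ M, ∀ t, ‖r t‖ ≤ M)
    (hi : Integrable (fun t => t ^ (-α) * r' t) halfLine) :
    ∫ t, marchaudKernel α ε t * (r 0 - r t) ∂halfLine
      = -∫ t, (t + ε) ^ (-α) * r' t ∂halfLine := by
  obtain ⟨M, hM⟩ := hb
  have hbound (t : ℝ) : ‖r 0 - r t‖ ≤ M + M :=
    (norm_sub_le _ _).trans (add_le_add (hM 0) (hM t))
  have hsub : Continuous fun t => r 0 - r t :=
    continuous_iff_continuousAt.2 fun t => ((hr t).const_sub (r 0)).continuousAt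
  have hzero : Tendsto (fun t => -(t + ε) ^ (-α) * (r 0 - r t)) (𝓝[>] 0) (𝓝 0) := by
    have hpow : ContinuousAt (fun t : ℝ => -(t + ε) ^ (-α)) 0 :=
      (hasDerivAt_neg_add_rpow (by linarith)).continuousAt
    simpa only [sub_self, mul_zero] using
      (hpow.tendsto.mul hsub.continuousAt).mono_left nhdsWithin_le_nhds
  have htop : Tendsto (fun t => -(t + ε) ^ (-α) * (r 0 - r t)) atTop (𝓝 0) := by
    have hpow : Tendsto (fun t : ℝ => -(t + ε) ^ (-α)) atTop (𝓝 0) := by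
      simpa using ((tendsto_rpow_neg_atTop hα).comp
        (tendsto_atTop_add_const_right atTop ε tendsto_id)).neg
    exact hpow.zero_mul_isBoundedUnder_le (isBoundedUnder_of ⟨M + M, hbound⟩)
  have hparts := integral_Ioi_mul_deriv_eq_deriv_mul
    (fun t ht => hasDerivAt_neg_add_rpow (add_pos ht hε)) (fun t _ => (hr t).const_sub (r 0))
    ((integrable_add_rpow_mul hα.le hε.le (measurable_of_hasDerivAt hr) hi).congr
      (Eventually.of_forall fun t => (neg_mul_neg _ _).symm))
    ((integrable_marchaudKernel hα hε).mul_bdd hsub.aestronglyMeasurable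
      (Eventually.of_forall hbound)) hzero htop
  simp only [neg_mul_neg, sub_zero, zero_sub] at hparts
  exact (neg_eq_iff_eq_neg.1 hparts.symm)

lemma HasMarchaudDeriv.inner_eq {H : Type*} [NormedAddCommGroup H] [InnerProductSpace ℝ H]
    [CompleteSpace H] (hα : 0 < α) {γ : ℝ → H} (hγ : Continuous γ) (hM : ∃ M, ∀ t, ‖γ t‖ ≤ M)
    {G : H} (hG : HasMarchaudDeriv α γ G) {v : H}
    (hr : ∀ t, HasDerivAt (fun t => inner ℝ v (γ t)) (r' t) t)
    (hi : Integrable (fun t => t ^ (-α) * r' t) halfLine) :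
    inner ℝ v G = -∫ t, t ^ (-α) * r' t ∂halfLine := by
  have hbound : ∃ M, ∀ t, ‖inner ℝ v (γ t)‖ ≤ M :=
    hM.imp' (‖v‖ * ·) fun M h t => (norm_inner_le_norm v (γ t)).trans (by gcongr; exact h t)
  refine tendsto_nhds_unique ((tendsto_const_nhds (x := v)).inner hG)
    ((tendsto_integral_add_rpow_mul hα.le (measurable_of_hasDerivAt hr) hi).neg.congr' ?_)
  filter_upwards [self_mem_nhdsWithin] with ε hε
  rw [inner_marchaud hα hε hγ hM, ← integral_marchaudKernel_mul_sub hα hε hr hbound hi]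
  simp only [inner_sub_right]

end WeakPairing

section TruncKernel

variable {α σ : ℝ} {f : ℝ → ℝ}

/-- The kernel `t ^ (-α)`, cut off outside the unit interval to make it integrable on `ℝ`. -/
def truncKernel (α : ℝ) : ℝ → ℝ := indicator (Ioo 0 1) (fun t => t ^ (-α))

lemma integrable_truncKernel (hα1 : α < 1) : Integrable (truncKernel α) := by
  rw [truncKernel, integrable_indicator_iff measurableSet_Ioo]
  have hint := intervalIntegral.intervalIntegrable_rpow' (a := 0) (b := 1) (neg_lt_neg hα1)
  rwa [intervalIntegrable_iff_integrableOn_Ioo_of_le zero_le_one] at hint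

lemma indicator_rpow_mul_eq (hf : ∀ t, 1 ≤ t → f t = 0) :
    indicator (Ioi 0) (fun t => t ^ (-α) * f t) = fun t => truncKernel α t * f t := by
  funext t
  rcases le_or_gt 1 t with h₁ | h₁
  · simp [indicator, hf t h₁]
  · simp [indicator, truncKernel, h₁]

lemma integral_rpow_mul_halfLine (hf : ∀ t, 1 ≤ t → f t = 0) :
    ∫ t, t ^ (-α) * f t ∂halfLine = ∫ t, truncKernel α t * f t := by
  rw [halfLine, ← integral_indicator measurableSet_Ioi, indicator_rpow_mul_eq hf]

lemma integrable_rpow_mul_halfLine (hα1 : α < 1) (hfc : Continuous f)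
    (hf : ∀ t, 1 ≤ t → f t = 0) : Integrable (fun t => t ^ (-α) * f t) halfLine := by
  rw [halfLine, ← IntegrableOn, ← integrable_indicator_iff measurableSet_Ioi,
    indicator_rpow_mul_eq hf, ← integrableOn_iff_integrable_of_support_subset (s := Icc 0 1)]
  · exact (integrable_truncKernel hα1).integrableOn.mul_continuousOn hfc.continuousOn isCompact_Icc
  · exact (Function.support_mul_subset_left _ _).trans
      (support_indicator_subset.trans Ioo_subset_Icc_self)

/-- The convolution of `u` with the truncated kernel on the positive (`σ = 1`) or negative
(`σ = -1`) half-line: on `Omega` a fractional integral of `u` up to a constant factor. -/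
def truncConv (α σ : ℝ) (u : ℝ → ℝ) : ℝ → ℝ :=
  convolution (fun t => truncKernel α (σ * t)) u (ContinuousLinearMap.mul ℝ ℝ) volume

variable {u ψ : ℝ → ℝ}

lemma integrable_truncConv (hα1 : α < 1) (hσ : σ ≠ 0) (hu : Integrable u) :
    Integrable (truncConv α σ u) :=
  ((integrable_truncKernel hα1).comp_mul_left' hσ).integrable_convolution _ hu

lemma integral_truncConv_mul (hα1 : α < 1) (hσ : |σ| = 1) (hu : Integrable u)
    (hu0 : ∀ᵐ x, x ∉ Omega → u x = 0) (hψ : Continuous ψ) (hc : HasCompactSupport ψ)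
    (hψ0 : ∀ x ∉ Omega, ψ x = 0) :
    ∫ x, truncConv α σ u x * ψ x = ∫ t, t ^ (-α) * correlation u ψ (σ * t) ∂halfLine := by
  have hσ0 : σ ≠ 0 := abs_ne_zero.1 (hσ ▸ one_ne_zero)
  have hσ2 : σ * σ = 1 := by rw [← abs_mul_abs_self, hσ, one_mul]
  have hfar (t : ℝ) (ht : 1 ≤ t) : correlation u ψ (σ * t) = 0 :=
    correlation_eq_zero hu0 hψ0 (by rw [abs_mul, hσ, one_mul]; exact ht.trans (le_abs_self t))
  have hflip :=
    Measure.integral_comp_mul_left (fun t => truncKernel α (σ * t) * correlation u ψ t) σ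
  simp only [← mul_assoc, hσ2, one_mul, abs_inv, hσ, inv_one, one_smul] at hflip
  rw [truncConv,
    integral_convolution_mul ((integrable_truncKernel hα1).comp_mul_left' hσ0) hu hψ hc,
    integral_rpow_mul_halfLine hfar, hflip]

lemma truncConv_eq_setIntegral (hσ : |σ| = 1) (hu0 : ∀ᵐ x, x ∉ Omega → u x = 0) {x : ℝ}
    (hx : x ∈ Omega) :
    truncConv α σ u x
      = ∫ y in {y | y ∈ Omega ∧ 0 < σ * (x - y)}, (σ * (x - y)) ^ (-α) * u y := by
  rw [← integral_indicator (by unfold Omega; measurability), truncConv, convolution_mul_swap]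
  refine integral_congr_ae ?_
  filter_upwards [hu0] with y hy
  by_cases hyΩ : y ∈ Omega
  · have hlt : σ * (x - y) < 1 := by
      refine (le_abs_self _).trans_lt ?_
      rw [abs_mul, hσ, one_mul]
      exact abs_lt.2 ⟨by linarith [hx.1, hyΩ.2], by linarith [hx.2, hyΩ.1]⟩
    simp [indicator, truncKernel, hyΩ, hlt]
  · simp [hy hyΩ, hyΩ]

lemma leftFracIntegral_eq_truncConv (hu0 : ∀ᵐ x, x ∉ Omega → u x = 0) {x : ℝ} (hx : x ∈ Omega) :
    leftFracIntegral 0 (1 - α) u x = 1 / Real.Gamma (1 - α) * truncConv α 1 u x := by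
  have hset : {y | y ∈ Omega ∧ 0 < 1 * (x - y)} = Ioo 0 x := by
    ext y
    have := hx.2
    simp only [Omega, mem_ofPred_eq, mem_Ioo]
    grind
  rw [leftFracIntegral, truncConv_eq_setIntegral (abs_one) hu0 hx, hset,
    intervalIntegral.integral_of_le hx.1.le, integral_Ioc_eq_integral_Ioo]
  simp only [sub_sub_cancel_left, one_mul]

lemma rightFracIntegral_eq_truncConv (hu0 : ∀ᵐ x, x ∉ Omega → u x = 0) {x : ℝ} (hx : x ∈ Omega) :
    rightFracIntegral 1 (1 - α) u x = 1 / Real.Gamma (1 - α) * truncConv α (-1) u x := by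
  have hset : {y | y ∈ Omega ∧ 0 < -1 * (x - y)} = Ioo x 1 := by
    ext y
    have := hx.1
    simp only [Omega, mem_ofPred_eq, mem_Ioo]
    grind
  rw [rightFracIntegral, truncConv_eq_setIntegral (by simp) hu0 hx, hset,
    intervalIntegral.integral_of_le hx.2.le, integral_Ioc_eq_integral_Ioo]
  simp only [sub_sub_cancel_left, neg_one_mul, neg_sub]

end TruncKernel

section RiemannLiouville

variable {α σ : ℝ} {u φ : ℝ → ℝ}

lemma integrable_of_memLp_two (hu : MemLp u 2 volume) (hu0 : ∀ᵐ x, x ∉ Omega → u x = 0) :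
    Integrable u := by
  have : IsFiniteMeasure (volume.restrict Omega) := by
    unfold Omega
    infer_instance
  exact IntegrableOn.integrable_of_ae_notMem_eq_zero
    ((hu.restrict Omega).integrable one_le_two) hu0

lemma HasMarchaudDeriv.integral_mul_eq (hα : 0 < α) (hα1 : α < 1) (hσ : |σ| = 1)
    (hu : MemLp u 2 volume) (hu0 : ∀ᵐ x, x ∉ Omega → u x = 0) {G : LineL2}
    (hG : HasMarchaudDeriv α (translateCurve σ (hu.toLp u)) G) (hφ : ContDiff ℝ 1 φ)
    (hc : HasCompactSupport φ) (hs : tsupport φ ⊆ Omega) :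
    ∫ x, G x * φ x = -(σ * ∫ x, truncConv α σ u x * deriv φ x) := by
  have hui := integrable_of_memLp_two hu hu0
  have hφL : MemLp φ 2 volume := hφ.continuous.memLp_of_hasCompactSupport hc
  have hφ' : Continuous (deriv φ) := hφ.continuous_deriv le_rfl
  have hφ'0 (x : ℝ) (hx : x ∉ Omega) : deriv φ x = 0 :=
    image_eq_zero_of_notMem_tsupport fun h => hx (hs (tsupport_deriv_subset h))
  have hcurve := isStationaryCurve_translateCurve hσ (hu.toLp u)
  have hderiv (t : ℝ) : HasDerivAt
      (fun t => inner ℝ (hφL.toLp φ) (translateCurve σ (hu.toLp u) t))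
      (σ * correlation u (deriv φ) (σ * t)) t := by
    simp only [translateCurve, inner_translate_toLp hu hφL]
    exact ((hasDerivAt_correlation hui hφ hc (σ * t)).comp t
      (hasDerivAt_const_mul σ)).congr_deriv (mul_comm _ _)
  have hint : Integrable (fun t => t ^ (-α) * (σ * correlation u (deriv φ) (σ * t))) halfLine := by
    refine integrable_rpow_mul_halfLine hα1 ?_ fun t ht => ?_
    · exact continuous_const.mul
        ((continuous_correlation hui hφ' hc.deriv).comp (continuous_const_mul σ))
    · rw [correlation_eq_zero hu0 hφ'0, mul_zero]
      rw [abs_mul, hσ, one_mul]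
      exact ht.trans (le_abs_self t)
  rw [← inner_toLp_left hφL, hG.inner_eq hα hcurve.continuous hcurve.bounded hderiv hint,
    integral_truncConv_mul hα1 hσ hui hu0 hφ' hc.deriv hφ'0, ← integral_const_mul]
  simp only [mul_left_comm]

lemma HasMarchaudDeriv.isWeakDerivOn (hα : 0 < α) (hα1 : α < 1) (hσ : |σ| = 1)
    (hu : MemLp u 2 volume) (hu0 : ∀ᵐ x, x ∉ Omega → u x = 0) {G : LineL2}
    (hG : HasMarchaudDeriv α (translateCurve σ (hu.toLp u)) G) {c : ℝ} {F : ℝ → ℝ}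
    (hF : ∀ x ∈ Omega, F x = c * truncConv α σ u x) :
    IsWeakDerivOn F (fun x => σ * (c * G x)) Omega := by
  have hΩ : MeasurableSet Omega := measurableSet_Ioo
  have hσ0 : σ ≠ 0 := abs_ne_zero.1 (hσ ▸ one_ne_zero)
  have hσ2 : σ * σ = 1 := by rw [← abs_mul_abs_self, hσ, one_mul]
  refine ⟨?_, ?_, fun φ hφ hc hs => ?_⟩
  · have hconv := (integrable_truncConv hα1 hσ0 (integrable_of_memLp_two hu hu0)).const_mul c
    exact (hconv.integrableOn.congr_fun (fun x hx => (hF x hx).symm) hΩ).locallyIntegrableOn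
  · have hGloc : LocallyIntegrable G := (Lp.memLp G).locallyIntegrable one_le_two
    exact ((hGloc.smul c).smul σ).locallyIntegrableOn _
  · have hφ0 (x : ℝ) (hx : x ∉ Omega) : φ x = 0 :=
      image_eq_zero_of_notMem_tsupport fun h => hx (hs h)
    have hφ'0 (x : ℝ) (hx : x ∉ Omega) : deriv φ x = 0 :=
      image_eq_zero_of_notMem_tsupport fun h => hx (hs (tsupport_deriv_subset h))
    have hleft : ∫ x in Omega, F x * deriv φ x = c * ∫ x, truncConv α σ u x * deriv φ x := by
      rw [setIntegral_congr_fun hΩ (g := fun x => c * (truncConv α σ u x * deriv φ x))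
        (fun x hx => by simp only [hF x hx, mul_assoc]), integral_const_mul,
        setIntegral_eq_integral_of_forall_compl_eq_zero (fun x hx => by rw [hφ'0 x hx, mul_zero])]
    have hright : ∫ x in Omega, σ * (c * G x) * φ x = σ * c * ∫ x, G x * φ x := by
      rw [setIntegral_eq_integral_of_forall_compl_eq_zero
        (fun x hx => by rw [hφ0 x hx, mul_zero]), ← integral_const_mul]
      simp only [mul_assoc]
    rw [hleft, hright, hG.integral_mul_eq hα hα1 hσ hu hu0 (hφ.of_le (by simp)) hc hs]
    linear_combination (-c * ∫ x, truncConv α σ u x * deriv φ x) * hσ2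

lemma integrableOn_mul_of_hasCompactSupport {g : ℝ → ℝ} {U : Set ℝ} (hU : MeasurableSet U)
    (hg : LocallyIntegrableOn g U) (hφ : Continuous φ) (hc : HasCompactSupport φ)
    (hs : tsupport φ ⊆ U) : IntegrableOn (fun x => g x * φ x) U := by
  have hK : IntegrableOn (fun x => g x * φ x) (tsupport φ) :=
    (hg.integrableOn_compact_subset hs hc).mul_continuousOn hφ.continuousOn hc
  refine hK.of_forall_sdiff_eq_zero hU fun x hx => ?_
  rw [image_eq_zero_of_notMem_tsupport hx.2, mul_zero]

lemma IsWeakDerivOn.ae_eq {F g₁ g₂ : ℝ → ℝ} {U : Set ℝ} (hU : IsOpen U)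
    (h₁ : IsWeakDerivOn F g₁ U) (h₂ : IsWeakDerivOn F g₂ U) : g₁ =ᵐ[volume.restrict U] g₂ := by
  suffices hzero : ∀ᵐ x, x ∈ U → (g₁ - g₂) x = 0 by
    rw [EventuallyEq, ae_restrict_iff' hU.measurableSet]
    filter_upwards [hzero] with x hx hxU
    exact sub_eq_zero.1 (hx hxU)
  refine hU.ae_eq_zero_of_integral_contDiff_smul_eq_zero (h₁.2.1.sub h₂.2.1) fun φ hφ hc hs => ?_
  have hint {g : ℝ → ℝ} (hg : LocallyIntegrableOn g U) : IntegrableOn (fun x => g x * φ x) U :=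
    integrableOn_mul_of_hasCompactSupport hU.measurableSet hg hφ.continuous hc hs
  calc ∫ x, φ x • (g₁ - g₂) x
      = ∫ x in U, φ x • (g₁ - g₂) x :=
        (setIntegral_eq_integral_of_forall_compl_eq_zero fun x hx => by
          rw [image_eq_zero_of_notMem_tsupport fun h => hx (hs h), zero_smul]).symm
    _ = ∫ x in U, (g₁ x * φ x - g₂ x * φ x) := by
        simp only [Pi.sub_apply, smul_eq_mul, mul_comm (φ _), sub_mul]
    _ = (∫ x in U, g₁ x * φ x) - ∫ x in U, g₂ x * φ x := integral_sub (hint h₁.2.1) (hint h₂.2.1)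
    _ = 0 := sub_eq_zero.2 (neg_injective ((h₁.2.2 φ hφ hc hs).symm.trans (h₂.2.2 φ hφ hc hs)))

lemma HasLeftRLDeriv.leftRLDeriv_ae_eq {g : ℝ → ℝ} (h : HasLeftRLDeriv α u g) :
    leftRLDeriv α u =ᵐ[volume.restrict Omega] g := by
  have hex : ∃ g, HasLeftRLDeriv α u g := ⟨g, h⟩
  rw [leftRLDeriv, dif_pos hex]
  exact hex.choose_spec.2.ae_eq isOpen_Ioo h.2

lemma HasRightRLDeriv.rightRLDeriv_ae_eq {g : ℝ → ℝ} (h : HasRightRLDeriv α u g) :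
    rightRLDeriv α u =ᵐ[volume.restrict Omega] g := by
  have hex : ∃ g, HasRightRLDeriv α u g := ⟨g, h⟩
  rw [rightRLDeriv, dif_pos hex]
  filter_upwards [hex.choose_spec.2.ae_eq isOpen_Ioo h.2] with x hx
  exact neg_injective hx

lemma HasMarchaudDeriv.hasLeftRLDeriv (hα : 0 < α) (hα1 : α < 1) (hu : MemLp u 2 volume)
    (hu0 : ∀ᵐ x, x ∉ Omega → u x = 0) {G : LineL2}
    (hG : HasMarchaudDeriv α (translateCurve 1 (hu.toLp u)) G) :
    HasLeftRLDeriv α u (fun x => 1 / Real.Gamma (1 - α) * G x) := by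
  refine ⟨((Lp.memLp G).restrict Omega).const_mul _, ?_⟩
  simpa only [one_mul] using hG.isWeakDerivOn hα hα1 abs_one hu hu0
    fun x hx => leftFracIntegral_eq_truncConv hu0 hx

lemma HasMarchaudDeriv.hasRightRLDeriv (hα : 0 < α) (hα1 : α < 1) (hu : MemLp u 2 volume)
    (hu0 : ∀ᵐ x, x ∉ Omega → u x = 0) {G : LineL2}
    (hG : HasMarchaudDeriv α (translateCurve (-1) (hu.toLp u)) G) :
    HasRightRLDeriv α u (fun x => 1 / Real.Gamma (1 - α) * G x) := by
  refine ⟨((Lp.memLp G).restrict Omega).const_mul _, ?_⟩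
  simpa only [neg_one_mul] using hG.isWeakDerivOn hα hα1 (by simp) hu hu0
    fun x hx => rightFracIntegral_eq_truncConv hu0 hx

end RiemannLiouville

section Seminorm

variable {α : ℝ} {u : ℝ → ℝ}

lemma integral_slobodeckijKernel_add (hu : MemLp u 2 volume) (α h : ℝ) :
    ∫ x, slobodeckijKernel α u (x, x + h) = incr (hu.toLp u) |h| * |h| ^ (-1 - 2 * α) := by
  rw [incr_abs, ← incr_neg, incr_toLp, ← neg_add', Real.rpow_neg (abs_nonneg h), ← div_eq_mul_inv,
    ← integral_div]
  congr 1 with x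
  rw [slobodeckijKernel, sub_neg_eq_add, sub_add_cancel_left, abs_neg, ← neg_sub, neg_sq]

lemma integrable_slobodeckijKernel_shear
    (hK : Integrable (slobodeckijKernel α u) (volume.prod volume)) :
    Integrable (fun p : ℝ × ℝ => slobodeckijKernel α u (p.1, p.1 + p.2)) (volume.prod volume) :=
  ((measurePreserving_prod_add volume volume).integrable_comp_emb measurableEmbedding_shear).2 hK

lemma integrable_incr (hu : MemLp u 2 volume)
    (hK : Integrable (slobodeckijKernel α u) (volume.prod volume)) :
    Integrable (fun h => incr (hu.toLp u) h * h ^ (-1 - 2 * α)) halfLine := by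
  have hint := (integrable_slobodeckijKernel_shear hK).integral_prod_right
  simp only [integral_slobodeckijKernel_add hu] at hint
  refine (hint.restrict (s := Ioi 0)).congr ?_
  filter_upwards [ae_restrict_mem measurableSet_Ioi] with h hh
  rw [abs_of_pos hh]

lemma integral_slobodeckijKernel (hu : MemLp u 2 volume)
    (hK : Integrable (slobodeckijKernel α u) (volume.prod volume)) :
    ∫ p, slobodeckijKernel α u p ∂(volume.prod volume)
      = 2 * ∫ h, incr (hu.toLp u) h * h ^ (-1 - 2 * α) ∂halfLine := by
  rw [← (measurePreserving_prod_add volume volume).integral_comp measurableEmbedding_shear,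
    integral_prod_symm _ (integrable_slobodeckijKernel_shear hK)]
  simp only [integral_slobodeckijKernel_add hu]
  exact integral_comp_abs (f := fun h => incr (hu.toLp u) h * h ^ (-1 - 2 * α))

lemma incr_of_one_le (hu : MemLp u 2 volume) (hu0 : ∀ᵐ x, x ∉ Omega → u x = 0) {h : ℝ}
    (hh : 1 ≤ h) : incr (hu.toLp u) h = 2 * ∫ x, u x ^ 2 := by
  have hdisjoint : ∀ᵐ x, (u (x - h) - u x) ^ 2 = u (x - h) ^ 2 + u x ^ 2 := by
    filter_upwards [hu0, ae_translate_eq_zero hu0 h] with x hx hxh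
    by_cases hxΩ : x ∈ Omega
    · rw [hxh fun hmem => by linarith [hxΩ.2, hmem.1]]
      ring
    · rw [hx hxΩ]
      ring
  rw [incr_toLp, integral_congr_ae hdisjoint,
    integral_add (hu.integrable_sq.comp_sub_right h) hu.integrable_sq,
    integral_sub_right_eq_self (fun x => u x ^ 2) h, two_mul]

lemma integral_sq_le (hα : 0 < α) (hu : MemHTilde α u) :
    ∫ x, u x ^ 2 ≤ α * ∫ h, incr (hu.1.toLp u) h * h ^ (-1 - 2 * α) ∂halfLine := by
  have htail : ∫ h in Ioi 1, incr (hu.1.toLp u) h * h ^ (-1 - 2 * α) = (∫ x, u x ^ 2) / α := by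
    rw [setIntegral_congr_fun measurableSet_Ioi
      (g := fun h => (2 * ∫ x, u x ^ 2) * h ^ (-1 - 2 * α))
      (fun h hh => by simp only [incr_of_one_le hu.1 hu.2.1 (le_of_lt hh)]), integral_const_mul,
      integral_Ioi_rpow_of_lt (by linarith) one_pos, Real.one_rpow,
      show -1 - 2 * α + 1 = -(2 * α) by ring]
    field_simp
  rw [← div_le_iff₀' hα, ← htail]
  refine setIntegral_mono_set (integrable_incr hu.1 hu.2.2) ?_
    (Ioi_subset_Ioi zero_le_one).eventuallyLE
  filter_upwards [ae_restrict_mem measurableSet_Ioi] with h hh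
  exact mul_nonneg (sq_nonneg _) (Real.rpow_nonneg (le_of_lt hh) _)

lemma slobodeckijKernel_nonneg (α : ℝ) (u : ℝ → ℝ) (p : ℝ × ℝ) : 0 ≤ slobodeckijKernel α u p := by
  unfold slobodeckijKernel
  positivity

lemma hTildeNorm_sq (α : ℝ) (u : ℝ → ℝ) : hTildeNorm α u ^ 2
    = (∫ x, u x ^ 2) + ∫ p, slobodeckijKernel α u p ∂(volume.prod volume) :=
  Real.sq_sqrt (add_nonneg (integral_nonneg fun x => sq_nonneg (u x))
    (integral_nonneg (slobodeckijKernel_nonneg α u)))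

lemma hTildeNorm_sq_le (hα : 0 < α) (hu : MemHTilde α u) : hTildeNorm α u ^ 2
    ≤ (α + 2) * ∫ h, incr (hu.1.toLp u) h * h ^ (-1 - 2 * α) ∂halfLine := by
  rw [hTildeNorm_sq, integral_slobodeckijKernel hu.1 hu.2.2, add_mul]
  gcongr
  exact integral_sq_le hα hu

lemma hTildeNorm_sq_pos (hu : MemLp u 2 volume) (hne : ¬ u =ᵐ[volume] 0) :
    0 < hTildeNorm α u ^ 2 := by
  have hsq : 0 < ∫ x, u x ^ 2 := by
    refine (integral_nonneg fun x => sq_nonneg (u x)).lt_of_ne' fun hzero => hne ?_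
    rw [integral_eq_zero_iff_of_nonneg (fun x => sq_nonneg _) hu.integrable_sq] at hzero
    filter_upwards [hzero] with x hx
    exact pow_eq_zero_iff two_ne_zero |>.1 hx
  rw [hTildeNorm_sq]
  exact add_pos_of_pos_of_nonneg hsq (integral_nonneg (slobodeckijKernel_nonneg α u))

end Seminorm

section HTilde

variable {u v : ℝ → ℝ} {α σ : ℝ}

lemma aestronglyMeasurable_slobodeckijKernel (hu : AEMeasurable u) (α : ℝ) :
    AEStronglyMeasurable (slobodeckijKernel α u) (volume.prod volume) := by
  have hfst : AEMeasurable (fun p : ℝ × ℝ => u p.1) (volume.prod volume) :=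
    hu.comp_quasiMeasurePreserving Measure.quasiMeasurePreserving_fst
  have hsnd : AEMeasurable (fun p : ℝ × ℝ => u p.2) (volume.prod volume) :=
    hu.comp_quasiMeasurePreserving Measure.quasiMeasurePreserving_snd
  have hdist : Measurable (fun p : ℝ × ℝ => |p.1 - p.2| ^ (1 + 2 * α)) := by fun_prop
  exact (((hfst.sub hsnd).pow_const 2).div hdist.aemeasurable).aestronglyMeasurable

lemma slobodeckijKernel_sub_le (α : ℝ) (u v : ℝ → ℝ) (p : ℝ × ℝ) :
    slobodeckijKernel α (u - v) p
      ≤ 2 * slobodeckijKernel α u p + 2 * slobodeckijKernel α v p := by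
  simp only [slobodeckijKernel, Pi.sub_apply, ← mul_div_assoc, ← add_div]
  gcongr
  linarith [sq_nonneg ((u p.1 - u p.2) + (v p.1 - v p.2))]

lemma MemHTilde.sub (hu : MemHTilde α u) (hv : MemHTilde α v) : MemHTilde α (u - v) := by
  have huv := hu.1.sub hv.1
  refine ⟨huv, ?_, ?_⟩
  · filter_upwards [hu.2.1, hv.2.1] with x hux hvx hx
    rw [Pi.sub_apply, hux hx, hvx hx, sub_zero]
  · refine ((hu.2.2.const_mul 2).add (hv.2.2.const_mul 2)).mono'
      (aestronglyMeasurable_slobodeckijKernel huv.aestronglyMeasurable.aemeasurable α)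
      (Eventually.of_forall fun p => ?_)
    rw [Real.norm_of_nonneg (slobodeckijKernel_nonneg α _ p)]
    exact slobodeckijKernel_sub_le α u v p

lemma MemHTilde.exists_hasMarchaudDeriv (hu : MemHTilde α u) (hα : 0 < α) (hα1 : α < 1)
    (hσ : |σ| = 1) : ∃ G, HasMarchaudDeriv α (translateCurve σ (hu.1.toLp u)) G :=
  (isStationaryCurve_translateCurve hσ _).exists_hasMarchaudDeriv hα hα1
    (integrable_incr hu.1 hu.2.2)

lemma MemHTilde.exists_hasLeftRLDeriv (hu : MemHTilde α u) (hα : 0 < α) (hα1 : α < 1) :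
    ∃ g, HasLeftRLDeriv α u g :=
  (hu.exists_hasMarchaudDeriv hα hα1 abs_one).imp' _ fun _ hG =>
    hG.hasLeftRLDeriv hα hα1 hu.1 hu.2.1

lemma MemHTilde.exists_hasRightRLDeriv (hu : MemHTilde α u) (hα : 0 < α) (hα1 : α < 1) :
    ∃ g, HasRightRLDeriv α u g :=
  (hu.exists_hasMarchaudDeriv hα hα1 (by simp)).imp' _ fun _ hG =>
    hG.hasRightRLDeriv hα hα1 hu.1 hu.2.1

lemma HasMarchaudDeriv.translateCurve_ae_eq_zero (hα : 0 < α) (hσ : |σ| = 1)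
    (hu : MemLp u 2 volume) (hu0 : ∀ᵐ x, x ∉ Omega → u x = 0) {G : LineL2}
    (hG : HasMarchaudDeriv α (translateCurve σ (hu.toLp u)) G) {S : Set ℝ} (hS : MeasurableSet S)
    (hSΩ : ∀ t, 0 ≤ t → ∀ x ∈ S, x - σ * t ∉ Omega) : ∀ᵐ x, x ∈ S → G x = 0 := by
  have hcurve := isStationaryCurve_translateCurve hσ (hu.toLp u)
  have hvanish (t : ℝ) (ht : 0 ≤ t) :
      ∀ᵐ x, x ∈ S → translateCurve σ (hu.toLp u) t x = 0 := by
    rw [translateCurve, translate_toLp]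
    filter_upwards [(hu.comp_measurePreserving
      (measurePreserving_sub_right volume (σ * t))).coeFn_toLp, ae_translate_eq_zero hu0 (σ * t)]
      with x htoLp hx hxS
    rw [htoLp, Function.comp_apply, hx (hSΩ t ht x hxS)]
  refine hG.ae_eq_zero hα hcurve.continuous hcurve.bounded hS fun t ht => ?_
  filter_upwards [hvanish t ht.le, hvanish 0 le_rfl] with x hx hx0 hxS
  rw [hx hxS, hx0 hxS]

lemma integral_Omega_mul_eq_inner (hα : 0 < α) (hu : MemLp u 2 volume)
    (hu0 : ∀ᵐ x, x ∉ Omega → u x = 0) (hv : MemLp v 2 volume) (hv0 : ∀ᵐ x, x ∉ Omega → v x = 0)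
    {G G' : LineL2} (hG : HasMarchaudDeriv α (translateCurve 1 (hu.toLp u)) G)
    (hG' : HasMarchaudDeriv α (translateCurve (-1) (hv.toLp v)) G') :
    ∫ x in Omega, G x * G' x = inner ℝ G G' := by
  have hleft : ∀ᵐ x, x ∈ Iic 0 → G x = 0 :=
    hG.translateCurve_ae_eq_zero hα abs_one hu hu0 measurableSet_Iic fun t ht x hx hmem => by
      linarith [hmem.1, mem_Iic.1 hx]
  have hright : ∀ᵐ x, x ∈ Ici 1 → G' x = 0 :=
    hG'.translateCurve_ae_eq_zero hα (by simp) hv hv0 measurableSet_Ici fun t ht x hx hmem => by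
      linarith [hmem.2, mem_Ici.1 hx]
  rw [L2.inner_def, setIntegral_eq_integral_of_ae_compl_eq_zero]
  · simp only [RCLike.inner_apply, conj_trivial, mul_comm]
  · filter_upwards [hleft, hright] with x hx0 hx1 hx
    rcases le_or_gt x 0 with h0 | h0
    · rw [hx0 h0, zero_mul]
    · rw [hx1 (not_lt.1 fun h1 => hx ⟨h0, h1⟩), mul_zero]

end HTilde

section Form

variable {s : ℝ} {u v f : ℝ → ℝ}

lemma formA_eq_neg_inner (hs0 : 0 < s) (hs2 : s < 2) (hu : MemLp u 2 volume)
    (hu0 : ∀ᵐ x, x ∉ Omega → u x = 0) (hv : MemLp v 2 volume) (hv0 : ∀ᵐ x, x ∉ Omega → v x = 0)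
    {G G' : LineL2} (hG : HasMarchaudDeriv (s / 2) (translateCurve 1 (hu.toLp u)) G)
    (hG' : HasMarchaudDeriv (s / 2) (translateCurve (-1) (hv.toLp v)) G') :
    formA s u v = (1 / Real.Gamma (1 - s / 2)) ^ 2 * -inner ℝ G G' := by
  have hα : 0 < s / 2 := by linarith
  have hα1 : s / 2 < 1 := by linarith
  have hderiv : ∀ᵐ x ∂volume.restrict Omega, leftRLDeriv (s / 2) u x * rightRLDeriv (s / 2) v x
      = (1 / Real.Gamma (1 - s / 2)) ^ 2 * (G x * G' x) := by
    filter_upwards [(hG.hasLeftRLDeriv hα hα1 hu hu0).leftRLDeriv_ae_eq,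
      (hG'.hasRightRLDeriv hα hα1 hv hv0).rightRLDeriv_ae_eq] with x hleft hright
    rw [hleft, hright]
    ring
  rw [formA, integral_congr_ae hderiv, integral_const_mul,
    integral_Omega_mul_eq_inner hα hu hu0 hv hv0 hG hG', mul_neg]

lemma formA_sub_left (hs0 : 0 < s) (hs2 : s < 2) (hu : MemHTilde (s / 2) u)
    (hv : MemHTilde (s / 2) v) (hf : MemHTilde (s / 2) f) :
    formA s (u - v) f = formA s u f - formA s v f := by
  have hα : 0 < s / 2 := by linarith
  have hα1 : s / 2 < 1 := by linarith
  obtain ⟨G, hG⟩ := hu.exists_hasMarchaudDeriv hα hα1 abs_one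
  obtain ⟨K, hK⟩ := hv.exists_hasMarchaudDeriv hα hα1 abs_one
  obtain ⟨F, hF⟩ := hf.exists_hasMarchaudDeriv (σ := -1) hα hα1 (by simp)
  have hcurve (g : LineL2) := isStationaryCurve_translateCurve abs_one g
  have hGK := hG.sub hα (hcurve _).continuous (hcurve _).bounded (hcurve _).continuous
    (hcurve _).bounded hK
  rw [← translateCurve_sub, ← MemLp.toLp_sub] at hGK
  rw [formA_eq_neg_inner hs0 hs2 hu.1 hu.2.1 hf.1 hf.2.1 hG hF,
    formA_eq_neg_inner hs0 hs2 hv.1 hv.2.1 hf.1 hf.2.1 hK hF,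
    formA_eq_neg_inner hs0 hs2 (hu.sub hv).1 (hu.sub hv).2.1 hf.1 hf.2.1 hGK hF, inner_sub_left]
  ring

/-- The coercivity constant of the form on `H̃^{s/2}(0,1)` that this proof yields, positive for
`1 < s < 2`. -/
def coercivityConst (s : ℝ) : ℝ :=
  (1 / Real.Gamma (1 - s / 2)) ^ 2 * (s / 2 * (2 * (s / 2) - 1) * 4 ^ (s / 2) / (s / 2 + 2))

lemma coercivityConst_pos (hs1 : 1 < s) (hs2 : s < 2) : 0 < coercivityConst s := by
  have hΓ : 0 < Real.Gamma (1 - s / 2) := Real.Gamma_pos_of_pos (by linarith)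
  have hα : 0 < 2 * (s / 2) - 1 := by linarith
  unfold coercivityConst
  positivity

theorem coercivityConst_mul_sq_le_formA (hs1 : 1 ≤ s) (hs2 : s < 2) (hu : MemHTilde (s / 2) u) :
    coercivityConst s * hTildeNorm (s / 2) u ^ 2 ≤ formA s u u := by
  have hα : 0 < s / 2 := by linarith
  have hα1 : s / 2 < 1 := by linarith
  have hα2 : 0 ≤ 2 * (s / 2) - 1 := by linarith
  obtain ⟨G, hG⟩ := hu.exists_hasMarchaudDeriv hα hα1 abs_one
  obtain ⟨G', hG'⟩ := hu.exists_hasMarchaudDeriv (σ := -1) hα hα1 (by simp)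
  rw [formA_eq_neg_inner (by linarith) hs2 hu.1 hu.2.1 hu.1 hu.2.1 hG hG', coercivityConst,
    mul_assoc]
  refine mul_le_mul_of_nonneg_left ?_ (sq_nonneg _)
  calc s / 2 * (2 * (s / 2) - 1) * 4 ^ (s / 2) / (s / 2 + 2) * hTildeNorm (s / 2) u ^ 2
      ≤ s / 2 * (2 * (s / 2) - 1) * 4 ^ (s / 2) / (s / 2 + 2) * ((s / 2 + 2)
          * ∫ h, incr (hu.1.toLp u) h * h ^ (-1 - 2 * (s / 2)) ∂halfLine) := by
        gcongr
        exact hTildeNorm_sq_le hα hu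
    _ = s / 2 * (2 * (s / 2) - 1) * 4 ^ (s / 2)
          * ∫ h, incr (hu.1.toLp u) h * h ^ (-1 - 2 * (s / 2)) ∂halfLine := by
        field_simp
    _ ≤ -inner ℝ G G' := by
        rw [← translateCurve_one_neg] at hG'
        exact hG.le_neg_inner (isStationaryCurve_translateCurve abs_one _) (by linarith) hα1
          (integrable_incr hu.1 hu.2.2) hG'

end Form

end FracBVP

end

theorem theorem3p1 (s : ℝ) (hs1 : 1 < s) (hs2 : s < 2) :
    -- both fractional derivatives of order `s / 2` exist in `L²(0,1)`, so `A` is defined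
    (∀ u : ℝ → ℝ, FracBVP.MemHTilde (s / 2) u →
      (∃ g, FracBVP.HasLeftRLDeriv (s / 2) u g) ∧ ∃ g, FracBVP.HasRightRLDeriv (s / 2) u g) ∧
    -- coercivity
    (∃ c : ℝ, 0 < c ∧ ∀ u : ℝ → ℝ, FracBVP.MemHTilde (s / 2) u →
      c * FracBVP.hTildeNorm (s / 2) u ^ 2 ≤ FracBVP.formA s u u) ∧
    -- monotonicity, strict for distinct elements
    (∀ u v : ℝ → ℝ, FracBVP.MemHTilde (s / 2) u → FracBVP.MemHTilde (s / 2) v →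
      0 ≤ FracBVP.formA s u (u - v) - FracBVP.formA s v (u - v) ∧
      (¬ u =ᵐ[MeasureTheory.volume] v →
        0 < FracBVP.formA s u (u - v) - FracBVP.formA s v (u - v))) := by
  have hα : 0 < s / 2 := by linarith
  have hα1 : s / 2 < 1 := by linarith
  have hc := FracBVP.coercivityConst_pos hs1 hs2
  refine ⟨fun u hu => ⟨hu.exists_hasLeftRLDeriv hα hα1, hu.exists_hasRightRLDeriv hα hα1⟩,
    ⟨_, hc, fun u hu => FracBVP.coercivityConst_mul_sq_le_formA hs1.le hs2 hu⟩,
    fun u v hu hv => ?_⟩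
  have huv := hu.sub hv
  have hcoercive := FracBVP.coercivityConst_mul_sq_le_formA hs1.le hs2 huv
  rw [← FracBVP.formA_sub_left (by linarith) hs2 hu hv huv]
  refine ⟨(mul_nonneg hc.le (sq_nonneg _)).trans hcoercive, fun hne => ?_⟩
  have hsub : ¬ u - v =ᵐ[volume] 0 := fun h => hne (h.mono fun _ hx => sub_eq_zero.1 hx)
  exact (mul_pos hc (FracBVP.hTildeNorm_sq_pos huv.1 hsub)).trans_le hcoercive
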